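/- Let $K$ be a commutative unital ring. A Lie 2-algebra (2-term $L_\infty$-algebra) $\mathbb V$ over $K$ is a linear map $\partial\colon V_1\to V_0$ of $K$-modules with bilinear brackets $[\cdot,\cdot]\colon V_i\times V_j\to V_{i+j}$ ($i+j=0,1$) and an antisymmetric trilinear Jacobiator $\langle\cdot,\cdot,\cdot\rangle\colon V_0^3\to V_1$ such that, for $w,x,y,z\in V_0$ and $h,k\in V_1$: $[x,y]=-[y,x]$, $[x,h]=-[h,x]$, $\partial[x,h]=[x,\partial h]$, $[\partial h,k]=[h,\partial k]$ (this element is also written $[h,k]$), $\partial\langle x,y,z\rangle=[x,[y,z]]+[y,[z,x]]+[z,[x,y]]$, $\langle x,y,\partial h\rangle=[x,[y,h]]+[y,[h,x]]+[h,[x,y]]$, and $$[\langle x,y,z\rangle,w]-[\langle w,x,y\rangle,z]+[\langle z,w,x\rangle,y]-[\langle y,z,w\rangle,x]$$ $$=\langle[x,y],z,w\rangle+\langle[z,w],x,y\rangle+\langle[x,z],w,y\rangle+\langle[w,y],x,z\rangle+\langle[x,w],y,z\rangle+\langle[y,z],x,w\rangle.$$ **The 2-category $\mathbf{2TermL}_\infty$.**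 A morphism $f\colon\mathbb W\to\mathbb V$ consists of linear maps $f_i\colon W_i\to V_i$ ($i=0,1$) commuting with $\partial$ and an antisymmetric bilinear map $\varepsilon\colon W_0\times W_0\to V_1$ with $[f_0x,f_0y]-f_0[x,y]=\partial\varepsilon(x,y)$, $[f_0x,f_1k]-f_1[x,k]=\varepsilon(x,\partial k)$ and $\langle f_0x,f_0y,f_0z\rangle-f_1\langle x,y,z\rangle=\varepsilon(x,[y,z])+\varepsilon(y,[z,x])+\varepsilon(z,[x,y])+[f_0x,\varepsilon(y,z)]+[f_0y,\varepsilon(z,x)]+[f_0z,\varepsilon(x,y)]$. The composite of $(f_0,f_1,\varepsilon)$ followed by $(g_0,g_1,\delta)$ is $(g_0f_0,\,g_1f_1,\,g_1\varepsilon+\delta(f_0\cdot,f_0\cdot))$. A 2-morphism $g\Rightarrow f$ is a linear map $\theta\colon W_0\to V_1$ with $f_0-g_0=\partial\theta$, $f_1-g_1=\theta\partial$ and $[\theta x,\theta y]-\theta[x,y]=\varepsilon_f(x,y)-\varepsilon_g(x,y)+[g_0y,\theta x]+[\theta y,g_0x]$. Vertical composition is addition; whiskering $\theta$ with $e$ before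 it gives $\theta e_0$, and with $h$ after it gives $h_1\theta$. **The bicategory $\mathbf{2TermL}_\infty^\flat$.** A butterfly $\mathbb W\to\mathbb V$ is a $K$-module $E$ with an antisymmetric bilinear bracket and linear maps $\kappa\colon W_1\to E$, $\iota\colon V_1\to E$, $\sigma\colon E\to W_0$, $\rho\colon E\to V_0$ such that $\sigma\kappa=\partial$, $\rho\iota=\partial$, $\rho\kappa=0$, $0\to V_1\xrightarrow{\iota}E\xrightarrow{\sigma}W_0\to0$ is exact, $\rho$ and $\sigma$ preserve brackets, $[a,\iota h]=\iota[\rho a,h]$, $[a,\kappa l]=\kappa[\sigma a,l]$, and $\iota\langle\rho a,\rho b,\rho c\rangle+\kappa\langle\sigma a,\sigma b,\sigma c\rangle=[a,[b,c]]+[b,[c,a]]+[c,[a,b]]$. A morphism of butterflies is a linear map $E\to E'$ commuting with the brackets and with all four structure maps. The composite of $(E,\kappa,\iota,\sigma,\rho)\colon\mathbb W\to\mathbb V$ followed by $(F,\kappa',\iota',\sigma',\rho')\colon\mathbb V\to\mathbb U$ is the fibre product $E\times_{V_0}F$ modulo the image of $V_1$ under $(\iota,\kappa')$, with componentwise bracket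 and structure maps $(\kappa,0)$, $(0,\iota')$, $\sigma\circ\mathrm{pr}$, $\rho'\circ\mathrm{pr}$. The identity butterfly of $\mathbb V$ is the butterfly associated, as below, with the identity morphism of $\mathbb V$. Lie 2-algebras, butterflies and morphisms of butterflies form a bicategory $\mathbf{2TermL}_\infty^\flat$ in this way. **The butterfly construction.** A morphism $f\colon\mathbb W\to\mathbb V$ gives the butterfly $V_1\oplus W_0$ with $$[(k,x),(l,y)]=([k,l]+[f_0x,l]+[k,f_0y]+\varepsilon(x,y),[x,y]),$$ $\kappa(l)=(-f_1l,\partial l)$, $\iota(k)=(k,0)$, $\sigma(k,x)=x$, $\rho(k,x)=\partial k+f_0x$; a 2-morphism $\theta\colon g\Rightarrow f$ gives the morphism of butterflies $(k,x)\mapsto(k-\theta x,x)$. With the comparison isomorphisms $(u,x)\mapsto[(0,x),(u,f_0x)]$ for a composite of $f$ and $g$, this is a pseudofunctor $\Phi\colon\mathbf{2TermL}_\infty\to\mathbf{2TermL}_\infty^\flat$ that is the identity on objects. **Proposition.** (1) For every $K$ and all $\mathbb W,\mathbb V$, the functor $\mathbf{2TermL}_\infty(\mathbb W,\mathbb V)\to\mathbf{2TermL}_\infty^\flat(\mathbb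 W,\mathbb V)$ given by $\Phi$ is fully faithful, and a butterfly is isomorphic to one in its image if and only if its map $\sigma$ has a linear section. (2) For every class $P$ of Lie 2-algebras over $K$ whose degree-zero modules $V_0$ are all projective, $\Phi$ restricts to a biequivalence between the full sub-bicategories of $\mathbf{2TermL}_\infty$ and $\mathbf{2TermL}_\infty^\flat$ on $P$. (3) If the degree-zero modules of all Lie 2-algebras over $K$ are projective (for instance, if $K$ is a field), then $\Phi\colon\mathbf{2TermL}_\infty\to\mathbf{2TermL}_\infty^\flat$ is a biequivalence. Here a biequivalence is a pseudofunctor $F$ for which there is a pseudofunctor $G$ in the other direction such that $GF$ and $FG$ are equivalent to the identities in the bicategories of pseudofunctors, pseudonatural transformations and modifications. -/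

import Mathlib

open CategoryTheory
open scoped CategoryTheory.Bicategory

universe v u

/-! ### The 2-category of Lie 2-algebras -/

/-- A 2-term `L∞`-algebra over `K`. The bracket `V₀ × V₁ → V₁` is `act`; the bracket
`V₁ × V₀ → V₁` is the one determined by antisymmetry, `[h, x] = -act x h`. -/
structure TwoTermLInf (K : Type v) [CommRing K] where
  V₀ : Type u
  V₁ : Type u
  [grp₀ : AddCommGroup V₀]
  [grp₁ : AddCommGroup V₁]
  [mod₀ : Module K V₀]
  [mod₁ : Module K V₁]
  /-- the differential -/
  d : V₁ →ₗ[K] V₀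
  /-- the bracket `V₀ × V₀ → V₀` -/
  br : V₀ →ₗ[K] V₀ →ₗ[K] V₀
  /-- the bracket `V₀ × V₁ → V₁` -/
  act : V₀ →ₗ[K] V₁ →ₗ[K] V₁
  /-- the Jacobiator -/
  jac : V₀ →ₗ[K] V₀ →ₗ[K] V₀ →ₗ[K] V₁
  jac_swap₁₂ : ∀ x y z, jac x y z = -jac y x z
  jac_swap₂₃ : ∀ x y z, jac x y z = -jac x z y
  br_antisymm : ∀ x y, br x y = -br y x
  d_act : ∀ x h, d (act x h) = br x (d h)
  /-- `[∂h, k] = [h, ∂k]` -/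
  act_d : ∀ h k, act (d h) k = -act (d k) h
  d_jac : ∀ x y z, d (jac x y z) = br x (br y z) + br y (br z x) + br z (br x y)
  /-- `⟨x, y, ∂h⟩ = [x, [y, h]] + [y, [h, x]] + [h, [x, y]]` -/
  jac_d : ∀ x y h, jac x y (d h) = act x (act y h) + act y (-act x h) + -act (br x y) h
  /-- `[⟨x,y,z⟩, w] - [⟨w,x,y⟩, z] + [⟨z,w,x⟩, y] - [⟨y,z,w⟩, x] = …` -/
  jac_jac : ∀ x y z w,
    -act w (jac x y z) - -act z (jac w x y) + -act y (jac z w x) - -act x (jac y z w) =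
      jac (br x y) z w + jac (br z w) x y + jac (br x z) w y + jac (br w y) x z
        + jac (br x w) y z + jac (br y z) x w

namespace TwoTermLInf

attribute [instance] grp₀ grp₁ mod₀ mod₁

variable {K : Type v} [CommRing K]

/-- A (weak) morphism of 2-term `L∞`-algebras. -/
@[ext]
structure Mor (W V : TwoTermLInf.{v, u} K) where
  f₀ : W.V₀ →ₗ[K] V.V₀
  f₁ : W.V₁ →ₗ[K] V.V₁
  eps : W.V₀ →ₗ[K] W.V₀ →ₗ[K] V.V₁
  comm : ∀ h, V.d (f₁ h) = f₀ (W.d h)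
  eps_antisymm : ∀ x y, eps x y = -eps y x
  br_f₀ : ∀ x y, V.br (f₀ x) (f₀ y) - f₀ (W.br x y) = V.d (eps x y)
  act_f₁ : ∀ x k, V.act (f₀ x) (f₁ k) - f₁ (W.act x k) = eps x (W.d k)
  jac_f : ∀ x y z, V.jac (f₀ x) (f₀ y) (f₀ z) - f₁ (W.jac x y z) =
    eps x (W.br y z) + eps y (W.br z x) + eps z (W.br x y)
      + V.act (f₀ x) (eps y z) + V.act (f₀ y) (eps z x) + V.act (f₀ z) (eps x y)

/-- The identity morphism. -/
def Mor.id (V : TwoTermLInf.{v, u} K) : Mor V V where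
  f₀ := LinearMap.id
  f₁ := LinearMap.id
  eps := 0
  comm h := rfl
  eps_antisymm x y := by simp
  br_f₀ x y := by simp
  act_f₁ x k := by simp
  jac_f x y z := by simp

/-- Composition of morphisms, `f` first: `(g₀ f₀, g₁ f₁, g₁ ε + δ (f₀ × f₀))`. -/
def Mor.comp {W V U : TwoTermLInf.{v, u} K} (f : Mor W V) (g : Mor V U) : Mor W U where
  f₀ := g.f₀ ∘ₗ f.f₀
  f₁ := g.f₁ ∘ₗ f.f₁
  eps := f.eps.compr₂ g.f₁ + g.eps.compl₁₂ f.f₀ f.f₀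
  comm h := by simp [g.comm, f.comm]
  eps_antisymm x y := by
    simp only [LinearMap.add_apply, LinearMap.compr₂_apply, LinearMap.compl₁₂_apply]
    rw [f.eps_antisymm x y, g.eps_antisymm (f.f₀ x) (f.f₀ y), map_neg]
    abel
  br_f₀ x y := by
    have h1 := congrArg g.f₀ (f.br_f₀ x y)
    have h2 := g.br_f₀ (f.f₀ x) (f.f₀ y)
    have h3 := g.comm (f.eps x y)
    simp only [map_sub] at h1
    simp only [LinearMap.add_apply, LinearMap.compr₂_apply, LinearMap.compl₁₂_apply,
      LinearMap.comp_apply, map_add]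
    rw [← h2, h3, ← h1]
    abel
  act_f₁ x k := by
    have h1 := congrArg g.f₁ (f.act_f₁ x k)
    have h2 := g.act_f₁ (f.f₀ x) (f.f₁ k)
    simp only [map_sub] at h1
    simp only [LinearMap.add_apply, LinearMap.compr₂_apply, LinearMap.compl₁₂_apply,
      LinearMap.comp_apply]
    rw [← f.comm, ← h1, ← h2]
    abel
  jac_f x y z := by
    have h1 := congrArg g.f₁ (f.jac_f x y z)
    have h2 := g.jac_f (f.f₀ x) (f.f₀ y) (f.f₀ z)
    have key : ∀ a b c, g.eps (f.f₀ a) (V.br (f.f₀ b) (f.f₀ c)) =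
        g.eps (f.f₀ a) (f.f₀ (W.br b c)) + (U.act (g.f₀ (f.f₀ a)) (g.f₁ (f.eps b c))
          - g.f₁ (V.act (f.f₀ a) (f.eps b c))) := by
      intro a b c
      rw [g.act_f₁, ← f.br_f₀, map_sub]
      abel
    simp only [map_sub, map_add] at h1
    rw [key, key, key] at h2
    simp only [LinearMap.add_apply, LinearMap.compr₂_apply, LinearMap.compl₁₂_apply,
      LinearMap.comp_apply, map_add]
    rw [← sub_eq_zero] at h1 h2 ⊢
    rw [← add_zero (0 : U.V₁)]
    nth_rewrite 1 [← h1]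
    rw [← h2]
    abel

/-- `Trans g f` is the type of transformations from `g` to `f`. -/
@[ext]
structure Trans {W V : TwoTermLInf.{v, u} K} (g f : Mor W V) where
  θ : W.V₀ →ₗ[K] V.V₁
  f₀_sub : ∀ x, f.f₀ x - g.f₀ x = V.d (θ x)
  f₁_sub : ∀ h, f.f₁ h - g.f₁ h = θ (W.d h)
  /-- `[θ x, θ y] - θ [x, y] = ε_f (x, y) - ε_g (x, y) + [g₀ y, θ x] + [θ y, g₀ x]`,
  where `[h, k] = [∂h, k]` on `V₁`. -/
  br_θ : ∀ x y, V.act (V.d (θ x)) (θ y) - θ (W.br x y) =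
    f.eps x y - g.eps x y + V.act (g.f₀ y) (θ x) + -V.act (g.f₀ x) (θ y)

/-- The identity transformation. -/
def Trans.id {W V : TwoTermLInf.{v, u} K} (f : Mor W V) : Trans f f where
  θ := 0
  f₀_sub x := by simp
  f₁_sub h := by simp
  br_θ x y := by simp

/-- A transformation with vanishing `θ` between equal morphisms. -/
def Trans.ofEq {W V : TwoTermLInf.{v, u} K} {f g : Mor W V} (h : f = g) : Trans f g where
  θ := 0
  f₀_sub x := by simp [h]
  f₁_sub x := by simp [h]
  br_θ x y := by simp [h]

/-- Vertical composition of transformations. -/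
def Trans.comp {W V : TwoTermLInf.{v, u} K} {f g h : Mor W V} (s : Trans f g) (t : Trans g h) :
    Trans f h where
  θ := s.θ + t.θ
  f₀_sub x := by
    simp only [LinearMap.add_apply, map_add, ← s.f₀_sub, ← t.f₀_sub]
    abel
  f₁_sub x := by
    simp only [LinearMap.add_apply, ← s.f₁_sub, ← t.f₁_sub]
    abel
  br_θ x y := by
    have h1 := s.br_θ x y
    have h2 := t.br_θ x y
    have h3 : ∀ z k, V.act (g.f₀ z) k = V.act (f.f₀ z) k + V.act (V.d (s.θ z)) k := by
      intro z k
      rw [← s.f₀_sub, map_sub, LinearMap.sub_apply]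
      abel
    rw [h3, h3] at h2
    have h4 := V.act_d (t.θ x) (s.θ y)
    simp only [LinearMap.add_apply, map_add]
    rw [h4]
    rw [← sub_eq_zero] at h1 h2 ⊢
    rw [← add_zero (0 : V.V₁)]
    nth_rewrite 1 [← h1]
    rw [← h2]
    abel

/-- Precomposition of a transformation with a morphism. -/
def Trans.whiskerLeft {W V U : TwoTermLInf.{v, u} K} (f : Mor W V) {g h : Mor V U}
    (t : Trans g h) : Trans (f.comp g) (f.comp h) where
  θ := t.θ ∘ₗ f.f₀
  f₀_sub x := t.f₀_sub (f.f₀ x)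
  f₁_sub x := by
    simp only [Mor.comp, LinearMap.comp_apply, ← f.comm, ← t.f₁_sub]
  br_θ x y := by
    have h1 := t.br_θ (f.f₀ x) (f.f₀ y)
    have h2 : t.θ (V.br (f.f₀ x) (f.f₀ y)) =
        t.θ (f.f₀ (W.br x y)) + (h.f₁ (f.eps x y) - g.f₁ (f.eps x y)) := by
      rw [t.f₁_sub, ← f.br_f₀, map_sub]
      abel
    rw [h2] at h1
    simp only [Mor.comp, LinearMap.add_apply, LinearMap.compr₂_apply, LinearMap.compl₁₂_apply,
      LinearMap.comp_apply]
    rw [← sub_eq_zero] at h1 ⊢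
    rw [← h1]
    abel

/-- Postcomposition of a transformation with a morphism. -/
def Trans.whiskerRight {W V U : TwoTermLInf.{v, u} K} {f g : Mor W V} (t : Trans f g)
    (h : Mor V U) : Trans (f.comp h) (g.comp h) where
  θ := h.f₁ ∘ₗ t.θ
  f₀_sub x := by
    simp only [Mor.comp, LinearMap.comp_apply, h.comm, ← t.f₀_sub, map_sub]
  f₁_sub x := by
    simp only [Mor.comp, LinearMap.comp_apply, ← t.f₁_sub, map_sub]
  br_θ x y := by
    have h1 := congrArg h.f₁ (t.br_θ x y)
    simp only [map_sub, map_add, map_neg] at h1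
    have a1 := h.act_f₁ (V.d (t.θ x)) (t.θ y)
    have a2 := h.act_f₁ (f.f₀ x) (t.θ y)
    have a3 := h.act_f₁ (f.f₀ y) (t.θ x)
    have hg : ∀ z, g.f₀ z = f.f₀ z + V.d (t.θ z) := by
      intro z
      rw [← t.f₀_sub]
      abel
    have a4 := h.eps_antisymm (V.d (t.θ x)) (f.f₀ y)
    simp only [Mor.comp, LinearMap.add_apply, LinearMap.compr₂_apply, LinearMap.compl₁₂_apply,
      LinearMap.comp_apply, hg, map_add, a4]
    rw [← a1, ← a2, ← a3, h.comm]
    rw [← sub_eq_zero] at h1 ⊢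
    rw [← h1]
    abel

instance : CategoryStruct (TwoTermLInf.{v, u} K) where
  Hom W V := Mor W V
  id V := Mor.id V
  comp f g := Mor.comp f g

instance homCategory (W V : TwoTermLInf.{v, u} K) : Category (W ⟶ V) where
  Hom f g := Trans f g
  id f := Trans.id f
  comp s t := Trans.comp s t
  id_comp s := Trans.ext (zero_add s.θ)
  comp_id s := Trans.ext (add_zero s.θ)
  assoc s t r := Trans.ext (add_assoc s.θ t.θ r.θ)

theorem comp_assoc' {W V U T : TwoTermLInf.{v, u} K} (f : Mor W V) (g : Mor V U) (h : Mor U T) :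
    (f.comp g).comp h = f.comp (g.comp h) := by
  refine Mor.ext rfl rfl ?_
  ext x y
  simp [Mor.comp, add_assoc]

theorem id_comp' {W V : TwoTermLInf.{v, u} K} (f : Mor W V) : (Mor.id W).comp f = f := by
  refine Mor.ext rfl rfl ?_
  ext x y
  simp [Mor.comp, Mor.id]

theorem comp_id' {W V : TwoTermLInf.{v, u} K} (f : Mor W V) : f.comp (Mor.id V) = f := by
  refine Mor.ext rfl rfl ?_
  ext x y
  simp [Mor.comp, Mor.id]

/-- The invertible transformation with `θ = 0` given by an equality of morphisms. -/
def isoOfEq {W V : TwoTermLInf.{v, u} K} {f g : W ⟶ V} (h : f = g) : f ≅ g where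
  hom := Trans.ofEq h
  inv := Trans.ofEq h.symm
  hom_inv_id := Trans.ext (add_zero (0 : W.V₀ →ₗ[K] V.V₁))
  inv_hom_id := Trans.ext (add_zero (0 : W.V₀ →ₗ[K] V.V₁))

theorem isoOfEq_eq {W V : TwoTermLInf.{v, u} K} {f g : W ⟶ V} (h : f = g) :
    isoOfEq h = eqToIso h := by
  subst h
  rfl

theorem hom₂_ext {W V : TwoTermLInf.{v, u} K} {f g : W ⟶ V} {s t : f ⟶ g}
    (h : ∀ x, Trans.θ s x = Trans.θ t x) : s = t :=
  Trans.ext (LinearMap.ext h)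

/-- The 2-category of 2-term `L∞`-algebras, morphisms and transformations. -/
instance : Bicategory (TwoTermLInf.{v, u} K) where
  homCategory W V := homCategory W V
  whiskerLeft f _ _ t := Trans.whiskerLeft f t
  whiskerRight t h := Trans.whiskerRight t h
  associator f g h := isoOfEq (comp_assoc' f g h)
  leftUnitor f := isoOfEq (id_comp' f)
  rightUnitor f := isoOfEq (comp_id' f)
  whiskerLeft_id f g := hom₂_ext fun x => rfl
  whiskerLeft_comp f _ _ _ s t := hom₂_ext fun x => rfl
  id_whiskerLeft {a b f g} s := hom₂_ext fun x =>
    show Trans.θ s x = 0 + (Trans.θ s x + 0) by simp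
  comp_whiskerLeft {a b c d} f g h h' s := hom₂_ext fun x =>
    show Trans.θ s _ = 0 + (Trans.θ s _ + 0) by simp; rfl
  id_whiskerRight {a b c} f g := hom₂_ext fun x => map_zero (Mor.f₁ g)
  comp_whiskerRight s t i := hom₂_ext fun x => map_add (Mor.f₁ i) _ _
  whiskerRight_id {a b f g} s := hom₂_ext fun x =>
    show Trans.θ s x = 0 + (Trans.θ s x + 0) by simp
  whiskerRight_comp {a b c d f f'} s g h := hom₂_ext fun x =>
    show Mor.f₁ h (Mor.f₁ g (Trans.θ s x)) = 0 + (Mor.f₁ h (Mor.f₁ g (Trans.θ s x)) + 0) by simp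
  whisker_assoc {a b c d} f g g' s h := hom₂_ext fun x =>
    show Mor.f₁ h (Trans.θ s (Mor.f₀ f x)) = 0 + (Mor.f₁ h (Trans.θ s (Mor.f₀ f x)) + 0) by simp
  whisker_exchange {a b c f g h i} s t := hom₂_ext fun x => by
    change Trans.θ t (Mor.f₀ f x) + Mor.f₁ i (Trans.θ s x) =
      Mor.f₁ h (Trans.θ s x) + Trans.θ t (Mor.f₀ g x)
    have h1 := Trans.f₀_sub s x
    have h2 := Trans.f₁_sub t (Trans.θ s x)
    rw [← h1, map_sub] at h2
    rw [← sub_eq_zero] at h2 ⊢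
    rw [← h2]
    abel
  pentagon {a b c d e} f g h i := hom₂_ext fun x =>
    show Mor.f₁ i 0 + (0 + 0) = (0 + 0 : e.V₁) by simp
  triangle {a b c} f g := hom₂_ext fun x =>
    show (0 + 0 : c.V₁) = Mor.f₁ g 0 by simp

/-- It is strict, i.e. a 2-category. -/
instance : Bicategory.Strict (TwoTermLInf.{v, u} K) where
  id_comp f := id_comp' f
  comp_id f := comp_id' f
  assoc f g h := comp_assoc' f g h
  leftUnitor_eqToIso f := isoOfEq_eq _
  rightUnitor_eqToIso f := isoOfEq_eq _
  associator_eqToIso f g h := isoOfEq_eq _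

end TwoTermLInf

/-! ### The bicategory of butterflies -/

/-- A butterfly from `W` to `V`. -/
structure Butterfly {K : Type v} [CommRing K] (W V : TwoTermLInf.{v, u} K) where
  E : Type u
  [grp : AddCommGroup E]
  [mod : Module K E]
  κ : W.V₁ →ₗ[K] E
  ι : V.V₁ →ₗ[K] E
  σ : E →ₗ[K] W.V₀
  ρ : E →ₗ[K] V.V₀
  /-- the bracket of `E` -/
  br : E →ₗ[K] E →ₗ[K] E
  br_antisymm : ∀ a b, br a b = -br b a
  σ_κ : ∀ l, σ (κ l) = W.d l
  ρ_ι : ∀ h, ρ (ι h) = V.d h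
  /-- the NW-SE sequence is a complex -/
  ρ_κ : ∀ l, ρ (κ l) = 0
  /-- the NE-SW sequence is short exact -/
  ι_injective : Function.Injective ι
  exact : Function.Exact ι σ
  σ_surjective : Function.Surjective σ
  ρ_br : ∀ a b, ρ (br a b) = V.br (ρ a) (ρ b)
  σ_br : ∀ a b, σ (br a b) = W.br (σ a) (σ b)
  br_ι : ∀ a h, br a (ι h) = ι (V.act (ρ a) h)
  br_κ : ∀ a l, br a (κ l) = κ (W.act (σ a) l)
  jacobi : ∀ a b c, ι (V.jac (ρ a) (ρ b) (ρ c)) + κ (W.jac (σ a) (σ b) (σ c)) =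
    br a (br b c) + br b (br c a) + br c (br a b)

namespace Butterfly

attribute [instance] grp mod

variable {K : Type v} [CommRing K]

/-- A morphism of butterflies: a linear map commuting with the brackets and with all four
structure maps. -/
@[ext]
structure Mor {W V : TwoTermLInf.{v, u} K} (B B' : Butterfly W V) where
  φ : B.E →ₗ[K] B'.E
  φ_κ : ∀ l, φ (B.κ l) = B'.κ l
  φ_ι : ∀ h, φ (B.ι h) = B'.ι h
  σ_φ : ∀ a, B'.σ (φ a) = B.σ a
  ρ_φ : ∀ a, B'.ρ (φ a) = B.ρ a
  φ_br : ∀ a b, φ (B.br a b) = B'.br (φ a) (φ b)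

namespace Mor

variable {W V : TwoTermLInf.{v, u} K}

/-- The identity morphism of a butterfly. -/
def id (B : Butterfly W V) : Mor B B where
  φ := LinearMap.id
  φ_κ _ := rfl
  φ_ι _ := rfl
  σ_φ _ := rfl
  ρ_φ _ := rfl
  φ_br _ _ := rfl

/-- Composition of morphisms of butterflies, `s` first. -/
def comp {B C D : Butterfly W V} (s : Mor B C) (t : Mor C D) : Mor B D where
  φ := t.φ ∘ₗ s.φ
  φ_κ l := by simp [s.φ_κ, t.φ_κ]
  φ_ι l := by simp [s.φ_ι, t.φ_ι]
  σ_φ l := by simp [s.σ_φ, t.σ_φ]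
  ρ_φ l := by simp [s.ρ_φ, t.ρ_φ]
  φ_br a b := by simp [s.φ_br, t.φ_br]

theorem bijective {B C : Butterfly W V} (s : Mor B C) : Function.Bijective s.φ := by
  constructor
  · rw [injective_iff_map_eq_zero]
    intro a ha
    have h1 : B.σ a = 0 := by rw [← s.σ_φ, ha, map_zero]
    obtain ⟨k, rfl⟩ := (B.exact a).1 h1
    rw [s.φ_ι] at ha
    have : k = 0 := C.ι_injective (by rw [ha, map_zero])
    rw [this, map_zero]
  · intro c
    obtain ⟨b, hb⟩ := B.σ_surjective (C.σ c)
    have h1 : C.σ (c - s.φ b) = 0 := by rw [map_sub, s.σ_φ, hb, sub_self]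
    obtain ⟨k, hk⟩ := (C.exact _).1 h1
    refine ⟨b + B.ι k, ?_⟩
    rw [map_add, s.φ_ι, hk]
    abel

/-- The inverse of a morphism of butterflies. -/
noncomputable def inv {B C : Butterfly W V} (s : Mor B C) : Mor C B where
  φ := (LinearEquiv.ofBijective s.φ s.bijective).symm
  φ_κ l := by rw [LinearEquiv.coe_coe, LinearEquiv.symm_apply_eq]; exact (s.φ_κ l).symm
  φ_ι l := by rw [LinearEquiv.coe_coe, LinearEquiv.symm_apply_eq]; exact (s.φ_ι l).symm
  σ_φ a := by
    obtain ⟨b, rfl⟩ := s.bijective.2 a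
    rw [s.σ_φ, LinearEquiv.coe_coe, LinearEquiv.ofBijective_symm_apply_apply]
  ρ_φ a := by
    obtain ⟨b, rfl⟩ := s.bijective.2 a
    rw [s.ρ_φ, LinearEquiv.coe_coe, LinearEquiv.ofBijective_symm_apply_apply]
  φ_br a b := by
    obtain ⟨a, rfl⟩ := s.bijective.2 a
    obtain ⟨b, rfl⟩ := s.bijective.2 b
    rw [← s.φ_br]
    simp only [LinearEquiv.coe_coe, LinearEquiv.ofBijective_symm_apply_apply]

end Mor

instance homCategory (W V : TwoTermLInf.{v, u} K) : Category (Butterfly W V) where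
  Hom B C := Mor B C
  id B := Mor.id B
  comp s t := Mor.comp s t
  id_comp s := Mor.ext rfl
  comp_id s := Mor.ext rfl
  assoc s t r := Mor.ext rfl

theorem hom_ext {W V : TwoTermLInf.{v, u} K} {B C : Butterfly W V} {s t : B ⟶ C}
    (h : ∀ x, Mor.φ s x = Mor.φ t x) : s = t :=
  Mor.ext (LinearMap.ext h)

@[simp]
theorem comp_φ {W V : TwoTermLInf.{v, u} K} {B C D : Butterfly W V} (s : B ⟶ C) (t : C ⟶ D)
    (x : B.E) : Mor.φ (s ≫ t) x = Mor.φ t (Mor.φ s x) :=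
  rfl

@[simp]
theorem id_φ {W V : TwoTermLInf.{v, u} K} (B : Butterfly W V) (x : B.E) :
    Mor.φ (𝟙 B) x = x :=
  rfl

/-- Every morphism of butterflies is an isomorphism. -/
noncomputable def isoOfMor {W V : TwoTermLInf.{v, u} K} {B C : Butterfly W V} (s : Mor B C) :
    B ≅ C where
  hom := s
  inv := s.inv
  hom_inv_id := hom_ext fun x => 
    (LinearEquiv.ofBijective s.φ s.bijective).symm_apply_apply x
  inv_hom_id := hom_ext fun x =>
    (LinearEquiv.ofBijective s.φ s.bijective).apply_symm_apply x

theorem eq_conj {W V : TwoTermLInf.{v, u} K} {A A' B B' : Butterfly W V} (p : Mor A A')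
    (q : Mor B B') (a : A ⟶ B) (b : A' ⟶ B')
    (h : ∀ x, q.φ (Mor.φ a x) = Mor.φ b (p.φ x)) :
    a = (isoOfMor p).hom ≫ b ≫ (isoOfMor q).inv := by
  rw [← Category.assoc, Iso.eq_comp_inv]
  exact hom_ext h

theorem eq_conj_symm {W V : TwoTermLInf.{v, u} K} {A A' B B' : Butterfly W V} (p : Mor A A')
    (q : Mor B B') (a : A ⟶ B) (b : A' ⟶ B')
    (h : ∀ x, q.φ (Mor.φ a x) = Mor.φ b (p.φ x)) :
    b = (isoOfMor p).inv ≫ a ≫ (isoOfMor q).hom := by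
  rw [Iso.eq_inv_comp]
  exact (hom_ext h).symm

section Comp

variable {W V U T : TwoTermLInf.{v, u} K}

/-- The fibre product of `E` and `F` over `V₀`. -/
def fiberProd (B : Butterfly W V) (C : Butterfly V U) : Submodule K (B.E × C.E) :=
  LinearMap.ker (B.ρ ∘ₗ LinearMap.fst K B.E C.E - C.σ ∘ₗ LinearMap.snd K B.E C.E)

theorem mem_fiberProd {B : Butterfly W V} {C : Butterfly V U} {p : B.E × C.E} :
    p ∈ fiberProd B C ↔ B.ρ p.1 = C.σ p.2 := by
  simp [fiberProd, sub_eq_zero]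

/-- The diagonal map `(ι, κ')` from `V₁` to the fibre product. -/
def diag (B : Butterfly W V) (C : Butterfly V U) : V.V₁ →ₗ[K] fiberProd B C :=
  LinearMap.codRestrict _ (B.ι.prod C.κ) fun h => by
    rw [mem_fiberProd]
    exact (B.ρ_ι h).trans (C.σ_κ h).symm

/-- The fibre product of `E` and `F` over `V₀` modulo the diagonal image of `V₁`. -/
abbrev CompE (B : Butterfly W V) (C : Butterfly V U) : Type u :=
  fiberProd B C ⧸ LinearMap.range (diag B C)

/-- The class of a pair. -/
def pair {B : Butterfly W V} {C : Butterfly V U} (e : B.E) (f : C.E) (h : B.ρ e = C.σ f) :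
    CompE B C :=
  Submodule.Quotient.mk ⟨(e, f), mem_fiberProd.2 h⟩

theorem pair_surj {B : Butterfly W V} {C : Butterfly V U} (q : CompE B C) :
    ∃ e f h, q = pair (B := B) (C := C) e f h := by
  obtain ⟨⟨⟨e, f⟩, h⟩, rfl⟩ := Submodule.Quotient.mk_surjective _ q
  exact ⟨e, f, mem_fiberProd.1 h, rfl⟩

theorem quot_ext {B : Butterfly W V} {C : Butterfly V U} {e e' : B.E} {f f' : C.E}
    {h : B.ρ e = C.σ f} {h' : B.ρ e' = C.σ f'} (he : e = e') (hf : f = f') :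
    pair e f h = pair e' f' h' := by
  subst he hf
  rfl

theorem pair_eq_iff {B : Butterfly W V} {C : Butterfly V U} {e e' : B.E} {f f' : C.E}
    {h : B.ρ e = C.σ f} {h' : B.ρ e' = C.σ f'} :
    pair e f h = pair e' f' h' ↔ ∃ k, B.ι k = e - e' ∧ C.κ k = f - f' := by
  unfold pair
  rw [Submodule.Quotient.eq, LinearMap.mem_range]
  refine exists_congr fun k => ?_
  rw [Subtype.ext_iff, Prod.ext_iff]
  rfl

theorem pair_add {B : Butterfly W V} {C : Butterfly V U} {e e' : B.E} {f f' : C.E}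
    (h : B.ρ e = C.σ f) (h' : B.ρ e' = C.σ f') :
    pair e f h + pair e' f' h' = pair (e + e') (f + f') (by rw [map_add, map_add, h, h']) :=
  rfl

theorem pair_neg {B : Butterfly W V} {C : Butterfly V U} {e : B.E} {f : C.E}
    (h : B.ρ e = C.σ f) : -pair e f h = pair (-e) (-f) (by rw [map_neg, map_neg, h]) :=
  rfl

theorem pair_smul {B : Butterfly W V} {C : Butterfly V U} {e : B.E} {f : C.E} (r : K)
    (h : B.ρ e = C.σ f) :
    r • pair e f h = pair (r • e) (r • f) (by rw [map_smul, map_smul, h]) :=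
  rfl

/-- A linear map out of `CompE B C`. -/
def compLift {B : Butterfly W V} {C : Butterfly V U} {M : Type u} [AddCommGroup M] [Module K M]
    (L : fiberProd B C →ₗ[K] M) (hL : ∀ k, L (diag B C k) = 0) : CompE B C →ₗ[K] M :=
  Submodule.liftQ _ L (by rintro _ ⟨k, rfl⟩; exact hL k)

/-- The componentwise bracket, with values in `CompE B C`. -/
def brPair (B : Butterfly W V) (C : Butterfly V U) :
    fiberProd B C →ₗ[K] fiberProd B C →ₗ[K] CompE B C :=
  LinearMap.mk₂ K
    (fun p q => pair (B.br p.1.1 q.1.1) (C.br p.1.2 q.1.2) (by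
      rw [B.ρ_br, C.σ_br, mem_fiberProd.1 p.2, mem_fiberProd.1 q.2]))
    (fun p p' q => by simp [pair_add])
    (fun r p q => by simp [pair_smul])
    (fun p q q' => by simp [pair_add])
    (fun r p q => by simp [pair_smul])

theorem brPair_apply (B : Butterfly W V) (C : Butterfly V U) (p q : fiberProd B C) :
    brPair B C p q = pair (B.br p.1.1 q.1.1) (C.br p.1.2 q.1.2) (by
      rw [B.ρ_br, C.σ_br, mem_fiberProd.1 p.2, mem_fiberProd.1 q.2]) :=
  rfl

theorem zero_eq_pair (B : Butterfly W V) (C : Butterfly V U) :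
    (0 : CompE B C) = pair 0 0 (by rw [map_zero, map_zero]) :=
  rfl

theorem brPair_diag (B : Butterfly W V) (C : Butterfly V U) (p : fiberProd B C) (k : V.V₁) :
    brPair B C p (diag B C k) = 0 := by
  have h := mem_fiberProd.1 p.2
  rw [brPair_apply, zero_eq_pair, pair_eq_iff]
  refine ⟨V.act (B.ρ p.1.1) k, ?_, ?_⟩
  · rw [sub_zero]
    exact (B.br_ι _ _).symm
  · rw [sub_zero, h]
    exact (C.br_κ _ _).symm

/-- The bracket of the composite butterfly. -/
def compBr (B : Butterfly W V) (C : Butterfly V U) :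
    CompE B C →ₗ[K] CompE B C →ₗ[K] CompE B C :=
  compLift
    { toFun := fun p => compLift (brPair B C p) (brPair_diag B C p)
      map_add' := fun p p' => Submodule.linearMap_qext _ (LinearMap.ext fun q =>
        LinearMap.congr_fun (map_add (brPair B C) p p') q)
      map_smul' := fun r p => Submodule.linearMap_qext _ (LinearMap.ext fun q =>
        LinearMap.congr_fun (map_smul (brPair B C) r p) q) }
    (fun k => Submodule.linearMap_qext _ (LinearMap.ext fun q => by
      have h := brPair_diag B C q k
      change brPair B C (diag B C k) q = 0
      rw [← neg_eq_zero, ← h, brPair_apply, brPair_apply, pair_neg]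
      congr 1
      · exact (B.br_antisymm _ _).symm
      · exact (C.br_antisymm _ _).symm))

theorem compBr_pair {B : Butterfly W V} {C : Butterfly V U} {e e' : B.E} {f f' : C.E}
    (h : B.ρ e = C.σ f) (h' : B.ρ e' = C.σ f') :
    compBr B C (pair e f h) (pair e' f' h') =
      pair (B.br e e') (C.br f f') (by rw [B.ρ_br, C.σ_br, h, h']) :=
  rfl

/-- The map `(κ, 0)`. -/
def compκ (B : Butterfly W V) (C : Butterfly V U) : W.V₁ →ₗ[K] CompE B C :=
  Submodule.mkQ _ ∘ₗ LinearMap.codRestrict _ (B.κ.prod 0) fun l => by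
    rw [mem_fiberProd]
    exact (B.ρ_κ l).trans (map_zero C.σ).symm

/-- The map `(0, ι')`. -/
def compι (B : Butterfly W V) (C : Butterfly V U) : U.V₁ →ₗ[K] CompE B C :=
  Submodule.mkQ _ ∘ₗ LinearMap.codRestrict _ (LinearMap.prod 0 C.ι) fun l => by
    rw [mem_fiberProd]
    exact (map_zero B.ρ).trans (C.exact.apply_apply_eq_zero l).symm

theorem compκ_apply (B : Butterfly W V) (C : Butterfly V U) (k : W.V₁) :
    compκ B C k = pair (B.κ k) 0 ((B.ρ_κ k).trans (map_zero C.σ).symm) :=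
  rfl

theorem compι_apply (B : Butterfly W V) (C : Butterfly V U) (k : U.V₁) :
    compι B C k = pair 0 (C.ι k)
      ((map_zero B.ρ).trans (C.exact.apply_apply_eq_zero k).symm) :=
  rfl

/-- Composition of butterflies, `B` first. -/
def comp (B : Butterfly W V) (C : Butterfly V U) : Butterfly W U where
  E := CompE B C
  κ := compκ B C
  ι := compι B C
  σ := compLift (B.σ ∘ₗ LinearMap.fst K B.E C.E ∘ₗ (fiberProd B C).subtype)
    fun k => B.exact.apply_apply_eq_zero k
  ρ := compLift (C.ρ ∘ₗ LinearMap.snd K B.E C.E ∘ₗ (fiberProd B C).subtype) fun k => C.ρ_κ k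
  br := compBr B C
  br_antisymm a b := by
    obtain ⟨e, f, h, rfl⟩ := pair_surj a
    obtain ⟨e', f', h', rfl⟩ := pair_surj b
    rw [compBr_pair, compBr_pair, pair_neg]
    congr 1
    · exact B.br_antisymm _ _
    · exact C.br_antisymm _ _
  σ_κ l := B.σ_κ l
  ρ_ι h := C.ρ_ι h
  ρ_κ l := map_zero C.ρ
  ι_injective := by
    rw [injective_iff_map_eq_zero]
    intro k hk
    rw [compι_apply, zero_eq_pair, pair_eq_iff] at hk
    obtain ⟨h, h1, h2⟩ := hk
    have h3 : h = 0 := B.ι_injective (by rw [h1, map_zero, sub_self])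
    rw [h3, map_zero, sub_zero] at h2
    exact C.ι_injective (by rw [← h2, map_zero])
  exact q := by
    constructor
    · intro hq
      obtain ⟨e, f, h, rfl⟩ := pair_surj q
      change B.σ e = 0 at hq
      obtain ⟨k, rfl⟩ := (B.exact e).1 hq
      have h1 : C.σ (f - C.κ k) = 0 := by rw [map_sub, ← h, B.ρ_ι, C.σ_κ, sub_self]
      obtain ⟨l, hl⟩ := (C.exact _).1 h1
      refine ⟨l, ?_⟩
      rw [compι_apply, pair_eq_iff]
      exact ⟨-k, by simp, by rw [hl, map_neg]; abel⟩
    · rintro ⟨k, rfl⟩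
      exact map_zero B.σ
  σ_surjective w := by
    obtain ⟨e, rfl⟩ := B.σ_surjective w
    obtain ⟨f, hf⟩ := C.σ_surjective (B.ρ e)
    exact ⟨pair e f hf.symm, rfl⟩
  ρ_br a b := by
    obtain ⟨e, f, h, rfl⟩ := pair_surj a
    obtain ⟨e', f', h', rfl⟩ := pair_surj b
    exact C.ρ_br f f'
  σ_br a b := by
    obtain ⟨e, f, h, rfl⟩ := pair_surj a
    obtain ⟨e', f', h', rfl⟩ := pair_surj b
    exact B.σ_br e e'
  br_ι a k := by
    obtain ⟨e, f, h, rfl⟩ := pair_surj a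
    rw [compι_apply, compι_apply, compBr_pair]
    congr 1
    · exact map_zero _
    · exact C.br_ι f k
  br_κ a k := by
    obtain ⟨e, f, h, rfl⟩ := pair_surj a
    rw [compκ_apply, compκ_apply, compBr_pair]
    congr 1
    · exact B.br_κ e k
    · exact map_zero _
  jacobi a b c := by
    obtain ⟨e₁, f₁, h₁, rfl⟩ := pair_surj a
    obtain ⟨e₂, f₂, h₂, rfl⟩ := pair_surj b
    obtain ⟨e₃, f₃, h₃, rfl⟩ := pair_surj c
    simp only [compBr_pair, pair_add, compι_apply, compκ_apply]
    rw [pair_eq_iff]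
    refine ⟨-V.jac (B.ρ e₁) (B.ρ e₂) (B.ρ e₃), ?_, ?_⟩
    · rw [← B.jacobi, map_neg]
      change _ = 0 + B.κ (W.jac (B.σ e₁) (B.σ e₂) (B.σ e₃)) - _
      abel
    · rw [← C.jacobi, map_neg, h₁, h₂, h₃]
      change _ = C.ι (U.jac (C.ρ f₁) (C.ρ f₂) (C.ρ f₃)) + 0 - _
      abel

/-- The map on composites induced by a pair of morphisms of butterflies. -/
def hcompφ {B B' : Butterfly W V} {C C' : Butterfly V U} (s : Mor B B') (t : Mor C C') :
    CompE B C →ₗ[K] CompE B' C' :=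
  compLift
    (Submodule.mkQ _ ∘ₗ LinearMap.codRestrict (fiberProd B' C')
      (s.φ.prodMap t.φ ∘ₗ (fiberProd B C).subtype) fun p => by
        rw [mem_fiberProd]
        exact (s.ρ_φ _).trans ((mem_fiberProd.1 p.2).trans (t.σ_φ _).symm))
    fun k => by
      refine (Submodule.Quotient.mk_eq_zero _).2 ⟨k, Subtype.ext (Prod.ext ?_ ?_)⟩
      · exact (s.φ_ι k).symm
      · exact (t.φ_κ k).symm

theorem hcompφ_pair {B B' : Butterfly W V} {C C' : Butterfly V U} (s : Mor B B') (t : Mor C C')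
    {e : B.E} {f : C.E} (h : B.ρ e = C.σ f) :
    hcompφ s t (pair e f h) =
      pair (s.φ e) (t.φ f) ((s.ρ_φ e).trans (h.trans (t.σ_φ f).symm)) :=
  rfl

/-- Horizontal composition of morphisms of butterflies, componentwise. -/
def hcomp {B B' : Butterfly W V} {C C' : Butterfly V U} (s : Mor B B') (t : Mor C C') :
    Mor (comp B C) (comp B' C') where
  φ := hcompφ s t
  φ_κ l := by
    change hcompφ s t (compκ B C l) = compκ B' C' l
    rw [compκ_apply, compκ_apply, hcompφ_pair]
    congr 1
    · exact s.φ_κ l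
    · exact map_zero _
  φ_ι l := by
    change hcompφ s t (compι B C l) = compι B' C' l
    rw [compι_apply, compι_apply, hcompφ_pair]
    congr 1
    · exact map_zero _
    · exact t.φ_ι l
  σ_φ a := by
    obtain ⟨e, f, h, rfl⟩ := pair_surj a
    exact s.σ_φ e
  ρ_φ a := by
    obtain ⟨e, f, h, rfl⟩ := pair_surj a
    exact t.ρ_φ f
  φ_br a b := by
    obtain ⟨e, f, h, rfl⟩ := pair_surj a
    obtain ⟨e', f', h', rfl⟩ := pair_surj b
    change hcompφ s t (compBr B C (pair e f h) (pair e' f' h')) =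
      compBr B' C' (hcompφ s t (pair e f h)) (hcompφ s t (pair e' f' h'))
    rw [compBr_pair, hcompφ_pair, hcompφ_pair, hcompφ_pair, compBr_pair]
    congr 1
    · exact s.φ_br e e'
    · exact t.φ_br f f'

/-- The bracket on `V₁ ⊕ W₀` defined by a morphism `f : W → V`:
`[(k, x), (l, y)] = ([k, l] + [f₀ x, l] + [k, f₀ y] + ε(x, y), [x, y])`. -/
def ofMorBr (f : TwoTermLInf.Mor W V) :
    (V.V₁ × W.V₀) →ₗ[K] (V.V₁ × W.V₀) →ₗ[K] (V.V₁ × W.V₀) :=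
  LinearMap.mk₂ K
    (fun a b => (V.act (V.d a.1) b.1 + V.act (f.f₀ a.2) b.1 + -V.act (f.f₀ b.2) a.1
      + f.eps a.2 b.2, W.br a.2 b.2))
    (fun a a' b => by ext <;> simp; abel)
    (fun r a b => by ext <;> simp)
    (fun a b b' => by ext <;> simp; abel)
    (fun r a b => by ext <;> simp)

theorem ofMorBr_apply (f : TwoTermLInf.Mor W V) (k l : V.V₁) (x y : W.V₀) :
    ofMorBr f (k, x) (l, y) = (V.act (V.d k) l + V.act (f.f₀ x) l + -V.act (f.f₀ y) k
      + f.eps x y, W.br x y) :=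
  rfl

/-- The butterfly `V₁ ⊕ W₀` of a morphism `f : W → V`. -/
def ofMor (f : TwoTermLInf.Mor W V) : Butterfly W V where
  E := V.V₁ × W.V₀
  κ := LinearMap.prod (-f.f₁) W.d
  ι := LinearMap.inl K V.V₁ W.V₀
  σ := LinearMap.snd K V.V₁ W.V₀
  ρ := V.d ∘ₗ LinearMap.fst K V.V₁ W.V₀ + f.f₀ ∘ₗ LinearMap.snd K V.V₁ W.V₀
  br := ofMorBr f
  br_antisymm a b := by
    obtain ⟨k, x⟩ := a
    obtain ⟨l, y⟩ := b
    rw [ofMorBr_apply, ofMorBr_apply, V.act_d k l, f.eps_antisymm x y, W.br_antisymm x y]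
    ext
    · simp only [Prod.fst_neg]
      abel
    · rfl
  σ_κ l := rfl
  ρ_ι h := by simp
  ρ_κ l := by simp [f.comm]
  ι_injective := LinearMap.inl_injective
  exact := Function.Exact.inl_snd
  σ_surjective := Prod.snd_surjective
  ρ_br a b := by
    obtain ⟨k, x⟩ := a
    obtain ⟨l, y⟩ := b
    have h := V.br_antisymm (V.d k) (f.f₀ y)
    rw [ofMorBr_apply]
    simp only [LinearMap.add_apply, LinearMap.comp_apply, LinearMap.fst_apply,
      LinearMap.snd_apply, map_add, map_neg, V.d_act, ← f.br_f₀, h]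
    abel
  σ_br a b := rfl
  br_ι a h := by
    obtain ⟨k, x⟩ := a
    rw [LinearMap.inl_apply, ofMorBr_apply]
    ext <;> simp
  br_κ a l := by
    obtain ⟨k, x⟩ := a
    change ofMorBr f (k, x) (-f.f₁ l, W.d l) = (-f.f₁ (W.act x l), W.d (W.act x l))
    rw [ofMorBr_apply, ← f.comm, ← f.act_f₁, W.d_act, map_neg, V.act_d k, map_neg]
    ext
    · simp only
      abel
    · rfl
  jacobi a b c := by
    obtain ⟨k₁, x₁⟩ := a
    obtain ⟨k₂, x₂⟩ := b
    obtain ⟨k₃, x₃⟩ := c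
    simp only [ofMorBr_apply]
    refine Prod.ext ?_ ?_
    · change V.jac (V.d k₁ + f.f₀ x₁) (V.d k₂ + f.f₀ x₂) (V.d k₃ + f.f₀ x₃)
        + -f.f₁ (W.jac x₁ x₂ x₃) = _
      have hj := f.jac_f x₁ x₂ x₃
      have q : ∀ h k, V.act (V.d h) k = -V.act (V.d k) h := V.act_d
      have b0 : ∀ x y, V.br (f.f₀ x) (f.f₀ y) = f.f₀ (W.br x y) + V.d (f.eps x y) := by
        intro x y
        rw [← f.br_f₀]
        abel
      have b1 : ∀ x h, V.br x (V.d h) = V.d (V.act x h) := fun x h => (V.d_act x h).symm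
      have j3 : ∀ x y h, V.jac x y (V.d h) =
          V.act x (V.act y h) - V.act y (V.act x h) - V.act (V.br x y) h := by
        intro x y h
        rw [V.jac_d, map_neg]
        abel
      have j2 : ∀ x y z, V.jac x y z = -V.jac x z y := V.jac_swap₂₃
      have j1 : ∀ x y z, V.jac x y z = V.jac y z x := by
        intro x y z
        rw [V.jac_swap₁₂, V.jac_swap₂₃, neg_neg]
      have hj' : V.jac (f.f₀ x₁) (f.f₀ x₂) (f.f₀ x₃) = f.f₁ (W.jac x₁ x₂ x₃) + (
          f.eps x₁ (W.br x₂ x₃) + f.eps x₂ (W.br x₃ x₁) + f.eps x₃ (W.br x₁ x₂)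
          + V.act (f.f₀ x₁) (f.eps x₂ x₃) + V.act (f.f₀ x₂) (f.eps x₃ x₁)
          + V.act (f.f₀ x₃) (f.eps x₁ x₂)) := by
        rw [← hj]
        abel
      simp only [map_add, LinearMap.add_apply, map_neg]
      rw [j1 (V.d k₁) (f.f₀ x₂) (f.f₀ x₃), j2 (f.f₀ x₁) (V.d k₂) (f.f₀ x₃),
        j1 (V.d k₁) (f.f₀ x₂) (V.d k₃), hj']
      rw [j1 (V.d k₁) (V.d k₂) (f.f₀ x₃), j1 (V.d k₂) (f.f₀ x₃) (V.d k₁)]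
      simp only [j3, b0, b1, map_add, LinearMap.add_apply, Prod.fst_add]
      rw [q (V.act (V.d k₁) k₂) k₃, q (V.act (f.f₀ x₁) k₂) k₃, q (V.act (f.f₀ x₃) k₁) k₂,
        q (V.act (f.f₀ x₂) k₃) k₁, q k₃ k₁, q (f.eps x₂ x₃) k₁, q (f.eps x₁ x₃) k₂, q (f.eps x₁ x₂) k₃, f.eps_antisymm x₃ x₁,
        W.br_antisymm x₃ x₁]
      simp only [map_neg, LinearMap.neg_apply]
      abel
    · exact (zero_add _).trans (W.d_jac x₁ x₂ x₃)

/-- The identity butterfly: the bracket on `V₁ ⊕ V₀` is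
`[(k, x), (l, y)] = ([k, l] + [x, l] + [k, y], [x, y])`, and the structure maps are
`κ l = (-l, ∂l)`, `ι k = (k, 0)`, `σ (k, x) = x`, `ρ (k, x) = ∂k + x`. -/
def id (V : TwoTermLInf.{v, u} K) : Butterfly V V :=
  ofMor (TwoTermLInf.Mor.id V)

section Associator

variable {B : Butterfly W V} {C : Butterfly V U} {D : Butterfly U T}

/-- The class of a triple in the composite bracketed to the left. -/
def tripleL (e : B.E) (f : C.E) (g : D.E) (h₁ : B.ρ e = C.σ f) (h₂ : C.ρ f = D.σ g) :
    (comp (comp B C) D).E :=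
  pair (B := comp B C) (C := D) (pair e f h₁) g h₂

/-- The class of a triple in the composite bracketed to the right. -/
def tripleR (e : B.E) (f : C.E) (g : D.E) (h₁ : B.ρ e = C.σ f) (h₂ : C.ρ f = D.σ g) :
    (comp B (comp C D)).E :=
  pair (B := B) (C := comp C D) e (pair f g h₂) h₁

theorem tripleL_surj (x : (comp (comp B C) D).E) :
    ∃ (e : B.E) (f : C.E) (g : D.E) (h₁ : B.ρ e = C.σ f) (h₂ : C.ρ f = D.σ g),
      x = tripleL e f g h₁ h₂ := by
  obtain ⟨q, g, h, rfl⟩ := pair_surj (B := comp B C) (C := D) x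
  obtain ⟨e, f, h₁, rfl⟩ := pair_surj q
  exact ⟨e, f, g, h₁, h, rfl⟩

theorem tripleR_eq_of_tripleL_eq {e e' : B.E} {f f' : C.E} {g g' : D.E}
    {h₁ : B.ρ e = C.σ f} {h₂ : C.ρ f = D.σ g} {h₁' : B.ρ e' = C.σ f'} {h₂' : C.ρ f' = D.σ g'}
    (h : tripleL e f g h₁ h₂ = tripleL e' f' g' h₁' h₂') :
    tripleR e f g h₁ h₂ = tripleR e' f' g' h₁' h₂' := by
  obtain ⟨m, hm, hm'⟩ := (pair_eq_iff (B := comp B C) (C := D)).1 h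
  obtain ⟨k, hk, hk'⟩ := (pair_eq_iff (B := B) (C := C) (e := 0) (f := C.ι m) (e' := e - e')
    (f' := f - f') (h := (map_zero B.ρ).trans (C.exact.apply_apply_eq_zero m).symm)
    (h' := by rw [map_sub, map_sub, h₁, h₁'])).1 hm
  refine (pair_eq_iff (B := B) (C := comp C D)).2 ⟨-k, by rw [map_neg, hk]; abel, ?_⟩
  refine (pair_eq_iff (B := C) (C := D) (e := C.κ (-k)) (f := 0) (e' := f - f')
    (f' := g - g') (h := (C.ρ_κ _).trans (map_zero D.σ).symm)
    (h' := by rw [map_sub, map_sub, h₂, h₂'])).2 ⟨-m, ?_, ?_⟩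
  · rw [map_neg, map_neg, hk']
    abel
  · rw [map_neg, hm']
    abel

theorem exists_assoc (x : (comp (comp B C) D).E) :
    ∃ y : (comp B (comp C D)).E, ∀ (e : B.E) (f : C.E) (g : D.E) (h₁ : B.ρ e = C.σ f)
      (h₂ : C.ρ f = D.σ g), x = tripleL e f g h₁ h₂ → y = tripleR e f g h₁ h₂ := by
  obtain ⟨e, f, g, h₁, h₂, rfl⟩ := tripleL_surj x
  exact ⟨tripleR e f g h₁ h₂, fun _ _ _ _ _ h => tripleR_eq_of_tripleL_eq h⟩

/-- `[[e, f], g] ↦ [e, [f, g]]`, see `assocFun_tripleL`. -/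
noncomputable def assocFun (x : (comp (comp B C) D).E) : (comp B (comp C D)).E :=
  Classical.choose (exists_assoc x)

theorem assocFun_tripleL (e : B.E) (f : C.E) (g : D.E) (h₁ : B.ρ e = C.σ f)
    (h₂ : C.ρ f = D.σ g) : assocFun (tripleL e f g h₁ h₂) = tripleR e f g h₁ h₂ :=
  Classical.choose_spec (exists_assoc (tripleL e f g h₁ h₂)) e f g h₁ h₂ rfl

/-- The associator `[[e, f], g] ↦ [e, [f, g]]`, see `assoc_tripleL`. -/
noncomputable def assoc (B : Butterfly W V) (C : Butterfly V U) (D : Butterfly U T) :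
    Mor (comp (comp B C) D) (comp B (comp C D)) where
  φ :=
    { toFun := assocFun
      map_add' := fun x y => by
        obtain ⟨e, f, g, h₁, h₂, rfl⟩ := tripleL_surj x
        obtain ⟨e', f', g', h₁', h₂', rfl⟩ := tripleL_surj y
        rw [assocFun_tripleL, assocFun_tripleL]
        exact assocFun_tripleL (e + e') (f + f') (g + g')
          (by rw [map_add, map_add, h₁, h₁']) (by rw [map_add, map_add, h₂, h₂'])
      map_smul' := fun r x => by
        obtain ⟨e, f, g, h₁, h₂, rfl⟩ := tripleL_surj x
        rw [assocFun_tripleL]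
        exact assocFun_tripleL (r • e) (r • f) (r • g)
          (by rw [map_smul, map_smul, h₁]) (by rw [map_smul, map_smul, h₂]) }
  φ_κ l := assocFun_tripleL (B.κ l) 0 0 ((B.ρ_κ l).trans (map_zero C.σ).symm)
    ((map_zero C.ρ).trans (map_zero D.σ).symm)
  φ_ι l := assocFun_tripleL 0 0 (D.ι l) ((map_zero B.ρ).trans (map_zero C.σ).symm)
    ((map_zero C.ρ).trans (D.exact.apply_apply_eq_zero l).symm)
  σ_φ x := by
    obtain ⟨e, f, g, h₁, h₂, rfl⟩ := tripleL_surj x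
    exact congrArg (comp B (comp C D)).σ (assocFun_tripleL e f g h₁ h₂)
  ρ_φ x := by
    obtain ⟨e, f, g, h₁, h₂, rfl⟩ := tripleL_surj x
    exact congrArg (comp B (comp C D)).ρ (assocFun_tripleL e f g h₁ h₂)
  φ_br x y := by
    obtain ⟨e, f, g, h₁, h₂, rfl⟩ := tripleL_surj x
    obtain ⟨e', f', g', h₁', h₂', rfl⟩ := tripleL_surj y
    change assocFun ((comp (comp B C) D).br (tripleL e f g h₁ h₂) (tripleL e' f' g' h₁' h₂')) =
      (comp B (comp C D)).br (assocFun (tripleL e f g h₁ h₂))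
        (assocFun (tripleL e' f' g' h₁' h₂'))
    rw [assocFun_tripleL, assocFun_tripleL]
    exact assocFun_tripleL (B.br e e') (C.br f f') (D.br g g')
      (by rw [B.ρ_br, C.σ_br, h₁, h₁']) (by rw [C.ρ_br, D.σ_br, h₂, h₂'])

theorem assoc_tripleL (e : B.E) (f : C.E) (g : D.E) (h₁ : B.ρ e = C.σ f)
    (h₂ : C.ρ f = D.σ g) :
    (assoc B C D).φ (tripleL e f g h₁ h₂) = tripleR e f g h₁ h₂ :=
  assocFun_tripleL e f g h₁ h₂

end Associator

/-- The linear map `[(k, x), f] ↦ f - κ k`. -/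
def leftUnitorφ (B : Butterfly W V) : CompE (id W) B →ₗ[K] B.E :=
  compLift
    ((LinearMap.snd K (id W).E B.E - B.κ ∘ₗ LinearMap.fst K W.V₁ W.V₀ ∘ₗ
      LinearMap.fst K (id W).E B.E) ∘ₗ (fiberProd (id W) B).subtype)
    fun k => sub_self (B.κ k)

theorem leftUnitorφ_pair (B : Butterfly W V) (k : W.V₁) (x : W.V₀) (f : B.E)
    (h : (id W).ρ (k, x) = B.σ f) :
    leftUnitorφ B (pair (B := id W) (C := B) (k, x) f h) = f - B.κ k :=
  rfl

/-- The left unitor. -/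
def leftUnitor (B : Butterfly W V) : Mor (comp (id W) B) B where
  φ := leftUnitorφ B
  φ_κ l := by
    change 0 - B.κ (-l) = B.κ l
    rw [map_neg, sub_neg_eq_add, zero_add]
  φ_ι l := by
    change B.ι l - B.κ 0 = B.ι l
    rw [map_zero, sub_zero]
  σ_φ a := by
    obtain ⟨⟨k, x⟩, f, h, rfl⟩ := pair_surj (B := id W) (C := B) a
    change B.σ (f - B.κ k) = x
    have h' : W.d k + x = B.σ f := h
    rw [map_sub, B.σ_κ, ← h']
    abel
  ρ_φ a := by
    obtain ⟨⟨k, x⟩, f, h, rfl⟩ := pair_surj (B := id W) (C := B) a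
    change B.ρ (f - B.κ k) = B.ρ f
    rw [map_sub, B.ρ_κ, sub_zero]
  φ_br a b := by
    obtain ⟨⟨k, x⟩, f, h, rfl⟩ := pair_surj (B := id W) (C := B) a
    obtain ⟨⟨l, y⟩, g, h', rfl⟩ := pair_surj (B := id W) (C := B) b
    have e1 : W.d k + x = B.σ f := h
    have e2 : W.d l + y = B.σ g := h'
    change B.br f g - B.κ (W.act (W.d k) l + W.act x l + -W.act y k + 0) =
      B.br (f - B.κ k) (g - B.κ l)
    have e3 : B.br (B.κ k) g = -B.κ (W.act (B.σ g) k) := by rw [B.br_antisymm, B.br_κ]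
    simp only [map_sub, LinearMap.sub_apply, B.br_κ, e3, B.σ_κ, ← e1, ← e2, map_add,
      LinearMap.add_apply, map_neg, map_zero]
    rw [W.act_d l k, map_neg]
    abel

/-- The linear map `[e, (k, x)] ↦ e + ι k`. -/
def rightUnitorφ (B : Butterfly W V) : CompE B (id V) →ₗ[K] B.E :=
  compLift
    ((LinearMap.fst K B.E (id V).E + B.ι ∘ₗ LinearMap.fst K V.V₁ V.V₀ ∘ₗ
      LinearMap.snd K B.E (id V).E) ∘ₗ (fiberProd B (id V)).subtype)
    fun k => by
      change B.ι k + B.ι (-k) = 0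
      rw [map_neg, add_neg_cancel]

theorem rightUnitorφ_pair (B : Butterfly W V) (k : V.V₁) (x : V.V₀) (e : B.E)
    (h : B.ρ e = (id V).σ (k, x)) :
    rightUnitorφ B (pair (B := B) (C := id V) e (k, x) h) = e + B.ι k :=
  rfl

/-- The right unitor. -/
def rightUnitor (B : Butterfly W V) : Mor (comp B (id V)) B where
  φ := rightUnitorφ B
  φ_κ l := by
    change B.κ l + B.ι 0 = B.κ l
    rw [map_zero, add_zero]
  φ_ι l := by
    change 0 + B.ι l = B.ι l
    rw [zero_add]
  σ_φ a := by
    obtain ⟨e, ⟨k, x⟩, h, rfl⟩ := pair_surj (B := B) (C := id V) a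
    change B.σ (e + B.ι k) = B.σ e
    rw [map_add, B.exact.apply_apply_eq_zero, add_zero]
  ρ_φ a := by
    obtain ⟨e, ⟨k, x⟩, h, rfl⟩ := pair_surj (B := B) (C := id V) a
    change B.ρ (e + B.ι k) = V.d k + x
    have h' : B.ρ e = x := h
    rw [map_add, B.ρ_ι, h']
    abel
  φ_br a b := by
    obtain ⟨e, ⟨k, x⟩, h, rfl⟩ := pair_surj (B := B) (C := id V) a
    obtain ⟨e', ⟨l, y⟩, h', rfl⟩ := pair_surj (B := B) (C := id V) b
    have e1 : B.ρ e = x := h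
    have e2 : B.ρ e' = y := h'
    change B.br e e' + B.ι (V.act (V.d k) l + V.act x l + -V.act y k + 0) =
      B.br (e + B.ι k) (e' + B.ι l)
    have e3 : ∀ g, B.br (B.ι k) g = -B.ι (V.act (B.ρ g) k) := by
      intro g
      rw [B.br_antisymm, B.br_ι]
    simp only [map_add, LinearMap.add_apply, e3, B.br_ι, B.ρ_ι, e1, e2, map_neg, map_zero]
    rw [V.act_d l k, map_neg]
    abel

theorem assoc_pentagon {S : TwoTermLInf.{v, u} K} (A : Butterfly W V) (B : Butterfly V U)
    (C : Butterfly U T) (D : Butterfly T S) (x : (comp (comp (comp A B) C) D).E) :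
    (hcomp (Mor.id A) (assoc B C D)).φ ((assoc A (comp B C) D).φ
      ((hcomp (assoc A B C) (Mor.id D)).φ x)) =
      (assoc A B (comp C D)).φ ((assoc (comp A B) C D).φ x) := by
  obtain ⟨q, f, g, h₃, h₄, rfl⟩ := tripleL_surj (B := comp A B) (C := C) (D := D) x
  obtain ⟨a, b, h₁, rfl⟩ := pair_surj q
  have h₂ : B.ρ b = C.σ f := h₃
  have e1 : (hcomp (assoc A B C) (Mor.id D)).φ
      (tripleL (B := comp A B) (C := C) (D := D) (pair a b h₁) f g h₃ h₄) =
      tripleL (B := A) (C := comp B C) (D := D) a (pair b f h₂) g h₁ h₄ :=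
    quot_ext (B := comp A (comp B C)) (C := D)
      (h := ((assoc A B C).ρ_φ (tripleL a b f h₁ h₂)).trans h₄) (assoc_tripleL a b f h₁ h₂) rfl
  have e2 : (hcomp (Mor.id A) (assoc B C D)).φ
      (tripleR (B := A) (C := comp B C) (D := D) a (pair b f h₂) g h₁ h₄) =
      tripleR (B := A) (C := B) (D := comp C D) a b (pair f g h₄) h₁ h₂ :=
    quot_ext (B := A) (C := comp B (comp C D))
      (h := h₁.trans ((assoc B C D).σ_φ (tripleL b f g h₂ h₄)).symm) rfl
      (assoc_tripleL b f g h₂ h₄)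
  rw [e1]
  refine (congrArg (hcomp (Mor.id A) (assoc B C D)).φ (assoc_tripleL (B := A) (C := comp B C)
    (D := D) a (pair b f h₂) g h₁ h₄)).trans (e2.trans ?_)
  refine Eq.symm ((congrArg (assoc A B (comp C D)).φ (assoc_tripleL (B := comp A B) (C := C)
    (D := D) (pair a b h₁) f g h₃ h₄)).trans ?_)
  exact assoc_tripleL (B := A) (C := B) (D := comp C D) a b (pair f g h₄) h₁ h₂

theorem assoc_triangle (B : Butterfly W V) (C : Butterfly V U)
    (x : (comp (comp B (id V)) C).E) :
    (hcomp (Mor.id B) (leftUnitor C)).φ ((assoc B (id V) C).φ x) =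
      (hcomp (rightUnitor B) (Mor.id C)).φ x := by
  obtain ⟨e, ⟨k, y⟩, g, h₁, h₂, rfl⟩ := tripleL_surj (B := B) (C := id V) (D := C) x
  refine (congrArg (hcomp (Mor.id B) (leftUnitor C)).φ
    (assoc_tripleL (B := B) (C := id V) (D := C) e (k, y) g h₁ h₂)).trans ?_
  have e1 : B.ρ e = y := h₁
  have e2 : V.d k + y = C.σ g := h₂
  refine (pair_eq_iff (B := B) (C := C) (e := e) (f := g - C.κ k) (e' := e + B.ι k) (f' := g)
    (h := ?_) (h' := ?_)).2 ⟨-k, ?_, ?_⟩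
  · rw [map_sub, C.σ_κ, e1, ← e2]
    abel
  · rw [map_add, B.ρ_ι, e1, ← e2]
    abel
  · rw [map_neg]
    abel
  · rw [map_neg]
    abel

end Comp

end Butterfly

/-- The objects of the bicategory of butterflies: 2-term `L∞`-algebras. -/
structure TwoTermLInfFlat (K : Type v) [CommRing K] where
  /-- the underlying 2-term `L∞`-algebra -/
  as : TwoTermLInf.{v, u} K

namespace TwoTermLInfFlat

variable {K : Type v} [CommRing K]

instance : CategoryStruct (TwoTermLInfFlat.{v, u} K) where
  Hom W V := Butterfly W.as V.as
  id V := Butterfly.id V.as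
  comp B C := Butterfly.comp B C

/-- The bicategory of 2-term `L∞`-algebras, butterflies and morphisms of butterflies. -/
noncomputable instance : Bicategory (TwoTermLInfFlat.{v, u} K) where
  homCategory W V := Butterfly.homCategory W.as V.as
  whiskerLeft B _ _ t := Butterfly.hcomp (Butterfly.Mor.id B) t
  whiskerRight s C := Butterfly.hcomp s (Butterfly.Mor.id C)
  associator B C D := Butterfly.isoOfMor (Butterfly.assoc B C D)
  leftUnitor B := Butterfly.isoOfMor (Butterfly.leftUnitor B)
  rightUnitor B := Butterfly.isoOfMor (Butterfly.rightUnitor B)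
  whiskerLeft_id B C := Butterfly.hom_ext fun x => by
    obtain ⟨e, f, h, rfl⟩ := Butterfly.pair_surj x
    rfl
  whiskerLeft_comp B _ _ _ s t := Butterfly.hom_ext fun x => by
    obtain ⟨e, f, h, rfl⟩ := Butterfly.pair_surj x
    rfl
  id_whiskerLeft {W V B C} s := by
    refine Butterfly.eq_conj _ _ _ _ fun x => ?_
    obtain ⟨⟨k, x⟩, f, h, rfl⟩ := Butterfly.pair_surj (B := Butterfly.id W.as) (C := B) x
    change Butterfly.Mor.φ s f - Butterfly.κ C k = Butterfly.Mor.φ s (f - Butterfly.κ B k)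
    rw [map_sub, Butterfly.Mor.φ_κ]
  comp_whiskerLeft B C D D' s := by
    refine Butterfly.eq_conj _ _ _ _ fun x => ?_
    obtain ⟨e, f, g, h₁, h₂, rfl⟩ := Butterfly.tripleL_surj x
    exact (Butterfly.assoc_tripleL e f (Butterfly.Mor.φ s g) h₁
      (h₂.trans (Butterfly.Mor.σ_φ s g).symm)).trans (congrArg
        (Butterfly.hcomp (Butterfly.Mor.id B) (Butterfly.hcomp (Butterfly.Mor.id C) s)).φ
        (Butterfly.assoc_tripleL e f g h₁ h₂)).symm
  id_whiskerRight B C := Butterfly.hom_ext fun x => by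
    obtain ⟨e, f, h, rfl⟩ := Butterfly.pair_surj x
    rfl
  comp_whiskerRight s t C := Butterfly.hom_ext fun x => by
    obtain ⟨e, f, h, rfl⟩ := Butterfly.pair_surj x
    rfl
  whiskerRight_id {W V B C} s := by
    refine Butterfly.eq_conj _ _ _ _ fun x => ?_
    obtain ⟨e, ⟨k, x⟩, h, rfl⟩ := Butterfly.pair_surj (B := B) (C := Butterfly.id V.as) x
    change Butterfly.Mor.φ s e + Butterfly.ι C k = Butterfly.Mor.φ s (e + Butterfly.ι B k)
    rw [map_add, Butterfly.Mor.φ_ι]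
  whiskerRight_comp {_ _ _ _ B B'} s C D := by
    refine Butterfly.eq_conj_symm _ _ _ _ fun x => ?_
    obtain ⟨e, f, g, h₁, h₂, rfl⟩ := Butterfly.tripleL_surj x
    exact (Butterfly.assoc_tripleL (Butterfly.Mor.φ s e) f g
      ((Butterfly.Mor.ρ_φ s e).trans h₁) h₂).trans
        (congrArg (Butterfly.hcomp s (Butterfly.Mor.id (Butterfly.comp C D))).φ
          (Butterfly.assoc_tripleL e f g h₁ h₂)).symm
  whisker_assoc B C C' s D := by
    refine Butterfly.eq_conj _ _ _ _ fun x => ?_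
    obtain ⟨e, f, g, h₁, h₂, rfl⟩ := Butterfly.tripleL_surj x
    exact (Butterfly.assoc_tripleL e (Butterfly.Mor.φ s f) g
      (h₁.trans (Butterfly.Mor.σ_φ s f).symm) ((Butterfly.Mor.ρ_φ s f).trans h₂)).trans
        (congrArg (Butterfly.hcomp (Butterfly.Mor.id B)
          (Butterfly.hcomp s (Butterfly.Mor.id D))).φ
            (Butterfly.assoc_tripleL e f g h₁ h₂)).symm
  whisker_exchange s t := Butterfly.hom_ext fun x => by
    obtain ⟨e, f, h, rfl⟩ := Butterfly.pair_surj x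
    rfl
  pentagon A B C D := Butterfly.hom_ext fun x => Butterfly.assoc_pentagon A B C D x
  triangle B C := Butterfly.hom_ext fun x => Butterfly.assoc_triangle B C x

end TwoTermLInfFlat

/-! ### From morphisms to butterflies -/

namespace Butterfly

variable {K : Type v} [CommRing K]

/-- The morphism of butterflies `(k, x) ↦ (k - θ x, x)` given by a transformation `θ` from
`g` to `f`. -/
def ofTrans {W V : TwoTermLInf.{v, u} K} {g f : TwoTermLInf.Mor W V}
    (t : TwoTermLInf.Trans g f) : Mor (ofMor g) (ofMor f) where
  φ := LinearMap.prod
    (LinearMap.fst K V.V₁ W.V₀ - t.θ ∘ₗ LinearMap.snd K V.V₁ W.V₀) (LinearMap.snd K V.V₁ W.V₀)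
  φ_κ l := by
    change (-g.f₁ l - t.θ (W.d l), W.d l) = (-f.f₁ l, W.d l)
    rw [← t.f₁_sub]
    refine Prod.ext ?_ rfl
    simp only
    abel
  φ_ι h := by
    change (h - t.θ 0, (0 : W.V₀)) = (h, 0)
    rw [map_zero, sub_zero]
  σ_φ a := rfl
  ρ_φ a := by
    obtain ⟨k, x⟩ := a
    change V.d (k - t.θ x) + f.f₀ x = V.d k + g.f₀ x
    rw [map_sub, ← t.f₀_sub]
    abel
  φ_br a b := by
    obtain ⟨k, x⟩ := a
    obtain ⟨l, y⟩ := b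
    refine Prod.ext ?_ rfl
    change V.act (V.d k) l + V.act (g.f₀ x) l + -V.act (g.f₀ y) k + g.eps x y
        - t.θ (W.br x y) =
      V.act (V.d (k - t.θ x)) (l - t.θ y) + V.act (f.f₀ x) (l - t.θ y)
        + -V.act (f.f₀ y) (k - t.θ x) + f.eps x y
    have h := t.br_θ x y
    have hf : ∀ z, f.f₀ z = g.f₀ z + V.d (t.θ z) := by
      intro z
      rw [← t.f₀_sub]
      abel
    simp only [hf, map_sub, map_add, LinearMap.add_apply, LinearMap.sub_apply]
    rw [V.act_d (t.θ y) (t.θ x), V.act_d (t.θ y) k]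
    rw [← sub_eq_zero] at h ⊢
    rw [← h]
    abel

section

variable {W V U : TwoTermLInf.{v, u} K}

theorem ofMor_fiber (f : TwoTermLInf.Mor W V) (g : TwoTermLInf.Mor V U) (u : U.V₁) (x : W.V₀) :
    (ofMor f).ρ ((0, x) : V.V₁ × W.V₀) = (ofMor g).σ ((u, f.f₀ x) : U.V₁ × V.V₀) := by
  change V.d 0 + f.f₀ x = f.f₀ x
  rw [map_zero, zero_add]

/-- The element `[(0, x), (u, f₀ x)]` of the composite of the butterflies of `f` and `g`. -/
def compPt (f : TwoTermLInf.Mor W V) (g : TwoTermLInf.Mor V U) (u : U.V₁) (x : W.V₀) :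
    (comp (ofMor f) (ofMor g)).E :=
  pair (B := ofMor f) (C := ofMor g) ((0, x) : V.V₁ × W.V₀) ((u, f.f₀ x) : U.V₁ × V.V₀)
    (ofMor_fiber f g u x)

theorem compPt_eq_pair {f : TwoTermLInf.Mor W V} {g : TwoTermLInf.Mor V U} {u u' : U.V₁}
    {x : W.V₀} {k : V.V₁} {y : V.V₀}
    (h : (ofMor f).ρ ((k, x) : V.V₁ × W.V₀) = (ofMor g).σ ((u', y) : U.V₁ × V.V₀))
    (hu : u = u' + g.f₁ k) :
    compPt f g u x = pair (B := ofMor f) (C := ofMor g) ((k, x) : V.V₁ × W.V₀)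
      ((u', y) : U.V₁ × V.V₀) h := by
  have h' : V.d k + f.f₀ x = y := h
  refine (pair_eq_iff (B := ofMor f) (C := ofMor g)).2 ⟨-k, ?_, ?_⟩
  · change ((-k, 0) : V.V₁ × W.V₀) = (0 - k, x - x)
    rw [zero_sub, sub_self]
  · change ((-g.f₁ (-k), V.d (-k)) : U.V₁ × V.V₀) = (u - u', f.f₀ x - y)
    rw [hu, ← h', map_neg, map_neg, neg_neg]
    refine Prod.ext ?_ ?_
    · simp only
      abel
    · simp only
      abel

/-- The comparison `(u, x) ↦ [(0, x), (u, f₀ x)]` from the butterfly of a composite to the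
composite of the butterflies. -/
def ofMorComp (f : TwoTermLInf.Mor W V) (g : TwoTermLInf.Mor V U) :
    Mor (ofMor (f.comp g)) (comp (ofMor f) (ofMor g)) where
  φ :=
    { toFun := fun a : U.V₁ × W.V₀ => compPt f g a.1 a.2
      map_add' := fun a b => quot_ext (B := ofMor f) (C := ofMor g)
        (h' := by rw [map_add, map_add, ofMor_fiber, ofMor_fiber])
        (Prod.ext (add_zero _).symm rfl) (Prod.ext rfl (map_add f.f₀ a.2 b.2))
      map_smul' := fun r a => quot_ext (B := ofMor f) (C := ofMor g)
        (h' := by rw [map_smul, map_smul, ofMor_fiber])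
        (Prod.ext (smul_zero _).symm rfl) (Prod.ext rfl (map_smul f.f₀ r a.2)) }
  φ_κ l := compPt_eq_pair (f := f) (g := g) (u := -g.f₁ (f.f₁ l)) (x := W.d l) (u' := 0)
    (k := -f.f₁ l) (y := 0) ((ofMor f).ρ_κ l) (by rw [map_neg, zero_add])
  φ_ι u := quot_ext (B := ofMor f) (C := ofMor g) (h := ofMor_fiber f g u 0)
    (h' := (map_zero (ofMor f).ρ).trans ((ofMor g).exact.apply_apply_eq_zero u).symm)
    rfl (Prod.ext rfl (map_zero f.f₀))
  σ_φ a := rfl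
  ρ_φ a := rfl
  φ_br a b := by
    obtain ⟨u, x⟩ := a
    obtain ⟨v, y⟩ := b
    refine (compPt_eq_pair (f := f) (g := g) (x := W.br x y)
      (k := V.act (V.d 0) 0 + V.act (f.f₀ x) 0 + -V.act (f.f₀ y) 0 + f.eps x y)
      (u' := U.act (U.d u) v + U.act (g.f₀ (f.f₀ x)) v + -U.act (g.f₀ (f.f₀ y)) u
        + g.eps (f.f₀ x) (f.f₀ y)) (y := V.br (f.f₀ x) (f.f₀ y)) ?_ ?_)
    · change V.d (V.act (V.d 0) 0 + V.act (f.f₀ x) 0 + -V.act (f.f₀ y) 0 + f.eps x y)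
        + f.f₀ (W.br x y) = V.br (f.f₀ x) (f.f₀ y)
      simp only [map_zero, neg_zero, zero_add, ← f.br_f₀]
      abel
    · change U.act (U.d u) v + U.act (g.f₀ (f.f₀ x)) v + -U.act (g.f₀ (f.f₀ y)) u
        + (g.f₁ (f.eps x y) + g.eps (f.f₀ x) (f.f₀ y)) = _
      simp only [map_zero, neg_zero, zero_add]
      abel

theorem inv_apply {B C : Butterfly W V} (s : Mor B C) (x : B.E) : s.inv.φ (s.φ x) = x :=
  (LinearEquiv.ofBijective s.φ s.bijective).symm_apply_apply x

theorem hcomp_inv_apply (A : Butterfly W V) {B C : Butterfly V U} (s : Mor B C)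
    (y : (comp A B).E) :
    (hcomp (Mor.id A) s.inv).φ ((hcomp (Mor.id A) s).φ y) = y := by
  obtain ⟨e, f, he, rfl⟩ := pair_surj (B := A) (C := B) y
  exact quot_ext (B := A) (C := B) (e := e) (f := s.inv.φ (s.φ f))
    (h := by rw [inv_apply]; exact he) rfl (inv_apply s f)

theorem eq_comp₅ {A B C D D' E : Butterfly W V} (a : A ⟶ E) (p : A ⟶ B) (q : B ⟶ C)
    (r : C ⟶ D) (s : Mor D' D) (s' : D ⟶ D') (t : Mor E D')
    (hs : ∀ y, Mor.φ s' (s.φ y) = y)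
    (h : ∀ x, s.φ (t.φ (Mor.φ a x)) = Mor.φ r (Mor.φ q (Mor.φ p x))) :
    a = p ≫ q ≫ r ≫ s' ≫ (isoOfMor t).inv := by
  refine hom_ext fun x => ?_
  change Mor.φ a x = t.inv.φ (Mor.φ s' (Mor.φ r (Mor.φ q (Mor.φ p x))))
  rw [← h, hs, inv_apply]

end

end Butterfly

open TwoTermLInf in
/-- The butterfly construction as a pseudofunctor. It is the identity on objects, sends a
morphism `f : W → V` to its butterfly `V₁ ⊕ W₀`, and a transformation `θ` to
`(k, x) ↦ (k - θ x, x)`. -/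
noncomputable def butterflyFunctor (K : Type v) [CommRing K] :
    Pseudofunctor (TwoTermLInf.{v, u} K) (TwoTermLInfFlat.{v, u} K) where
  obj V := ⟨V⟩
  map f := Butterfly.ofMor f
  map₂ t := Butterfly.ofTrans t
  map₂_id f := Butterfly.hom_ext fun x => Prod.ext (sub_zero x.1) rfl
  map₂_comp s t := Butterfly.hom_ext fun x => Prod.ext (sub_add_eq_sub_sub x.1 _ _) rfl
  mapId V := Iso.refl (Butterfly.id V)
  mapComp f g := Butterfly.isoOfMor (Butterfly.ofMorComp f g)
  map₂_whisker_left f g h t := Butterfly.eq_conj _ _ _ _ fun x => rfl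
  map₂_whisker_right {_ _ _ f f'} t h := Butterfly.eq_conj _ _ _ _ fun x =>
    Butterfly.compPt_eq_pair (f := f') (g := h) (u := x.1 - Mor.f₁ h (Trans.θ t x.2)) (x := x.2)
      (u' := x.1) (k := 0 - Trans.θ t x.2) (y := Mor.f₀ f x.2)
      (((Butterfly.ofTrans t).ρ_φ _).trans (Butterfly.ofMor_fiber f h x.1 x.2))
      (by rw [map_sub, map_zero, zero_sub, sub_eq_add_neg])
  map₂_associator {W V U T} f g h := by
    refine Butterfly.eq_comp₅ _ _ _ _
      (Butterfly.hcomp (Butterfly.Mor.id (Butterfly.ofMor f)) (Butterfly.ofMorComp g h)) _ _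
      (fun y => ?_) (fun x => ?_)
    · exact Butterfly.hcomp_inv_apply (Butterfly.ofMor f) (Butterfly.ofMorComp g h) y
    · obtain ⟨u, x⟩ := x
      refine Eq.trans ?_ (Butterfly.assoc_tripleL (B := Butterfly.ofMor f)
        (C := Butterfly.ofMor g) (D := Butterfly.ofMor h) ((0, x) : V.V₁ × W.V₀)
        ((0, Mor.f₀ f x) : U.V₁ × V.V₀) ((u, Mor.f₀ g (Mor.f₀ f x)) : T.V₁ × U.V₀)
        (Butterfly.ofMor_fiber f g 0 x) (Butterfly.ofMor_fiber g h u (Mor.f₀ f x))).symm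
      exact Butterfly.quot_ext (B := Butterfly.ofMor f)
        (C := Butterfly.comp (Butterfly.ofMor g) (Butterfly.ofMor h))
        (e := ((0, x) : V.V₁ × W.V₀)) (f := Butterfly.compPt g h (u - 0) (Mor.f₀ f x))
        (h := Butterfly.ofMor_fiber f g 0 x) rfl
        (congrArg (fun v => Butterfly.compPt g h v (Mor.f₀ f x)) (sub_zero u))
  map₂_left_unitor {W V} f := Butterfly.hom_ext fun x => by
    have h : ∀ y : (Butterfly.ofMor f).E, y = y - Butterfly.κ (Butterfly.ofMor f) 0 := by
      intro y
      rw [map_zero, sub_zero]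
    have h' : ((x.1 - 0, x.2) : V.V₁ × W.V₀) = (x.1, x.2) := by rw [sub_zero]
    exact h'.trans (h ((x.1, x.2) : V.V₁ × W.V₀))
  map₂_right_unitor {W V} f := Butterfly.hom_ext fun x => by
    change (x.1 - 0, x.2) = ((0, x.2) : V.V₁ × W.V₀) + (x.1, 0)
    rw [sub_zero, Prod.mk_add_mk, zero_add, add_zero]

/-! ### Biequivalences -/

open CategoryTheory.Pseudofunctor.StrongTrans in
/-- A pseudofunctor `F` is a biequivalence if there is a pseudofunctor `G` in the other direction
such that both composites are equivalent to the identity in the bicategory of pseudofunctors,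
pseudonatural transformations and modifications. -/
def IsBiequivalence.{w₁, w₂, v₁, v₂, u₁, u₂} {B : Type u₁} [Bicategory.{w₁, v₁} B] {C : Type u₂}
    [Bicategory.{w₂, v₂} C] (F : Pseudofunctor B C) : Prop :=
  ∃ G : Pseudofunctor C B,
    Nonempty (Bicategory.Equivalence (F.comp G) (Pseudofunctor.id B)) ∧
    Nonempty (Bicategory.Equivalence (G.comp F) (Pseudofunctor.id C))

/-- The full sub-bicategory of `B` on the objects in `P`. -/
abbrev FullSub.{w, v₁, u₁} {B : Type u₁} [Bicategory.{w, v₁} B] (P : Set B) : Type u₁ :=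
  Bicategory.InducedBicategory B (Subtype.val : {b : B // b ∈ P} → B)

open Bicategory in
/-- The restriction of a pseudofunctor `F : B → C` to the full sub-bicategories on `P` and `Q`,
where `F` maps `P` into `Q`. -/
def restrictFull.{w₁, w₂, v₁, v₂, u₁, u₂} {B : Type u₁} [Bicategory.{w₁, v₁} B] {C : Type u₂}
    [Bicategory.{w₂, v₂} C] (F : Pseudofunctor B C) (P : Set B) (Q : Set C)
    (h : ∀ b ∈ P, F.obj b ∈ Q) : Pseudofunctor (FullSub P) (FullSub Q) where
  obj b := (⟨F.obj b.1, h b.1 b.2⟩ : {c : C // c ∈ Q})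
  map f := InducedBicategory.mkHom (F.map f.hom)
  map₂ η := InducedBicategory.mkHom₂ (F.map₂ η.hom)
  map₂_id f := InducedBicategory.hom₂_ext (F.map₂_id f.hom)
  map₂_comp η θ := InducedBicategory.hom₂_ext (F.map₂_comp η.hom θ.hom)
  mapId b := InducedBicategory.isoMk (F.mapId b.1)
  mapComp f g := InducedBicategory.isoMk (F.mapComp f.hom g.hom)
  map₂_whisker_left f _ _ η := InducedBicategory.hom₂_ext (F.map₂_whisker_left f.hom η.hom)
  map₂_whisker_right η f := InducedBicategory.hom₂_ext (F.map₂_whisker_right η.hom f.hom)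
  map₂_associator f g k :=
    InducedBicategory.hom₂_ext (F.map₂_associator f.hom g.hom k.hom)
  map₂_left_unitor {W V} f := InducedBicategory.hom₂_ext (F.map₂_left_unitor f.hom)
  map₂_right_unitor f := InducedBicategory.hom₂_ext (F.map₂_right_unitor f.hom)

/-!
# The butterfly construction is a biequivalence

On hom-categories everything is explicit. A morphism of butterflies `V₁ ⊕ W₀ ⟶ V₁ ⊕ W₀` is the
identity on `V₁` and induces the identity on `W₀`, so it has the form `(k, x) ↦ (k - θ x, x)` for a
unique linear map `θ`, and the axioms of a transformation for `θ` are those of a morphism of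
butterflies (`Butterfly.toTrans`). A butterfly of a morphism has the section `x ↦ (0, x)`;
conversely a linear section `s` of `σ` splits a butterfly `E` as a module, and transporting its
structure along `V₁ ⊕ W₀ ≅ E` gives a morphism with `f₀ = ρ s`, `ι f₁ = s ∂ - κ` and
`ι ε(x, y) = [s x, s y] - s [x, y]` (`Butterfly.morOfSection`, `Butterfly.ofMorOfSection`). If `W₀`
is projective, a section always exists, and the construction is an equivalence on
hom-categories.

Since it is also bijective on objects, it remains to prove the Whitehead theorem for bicategories
(`isBiequivalence_of_isEquivalence_mapFunctor`). Let `F : B → C` be an equivalence on hom-categories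
and surjective on objects up to equivalence. Choosing equivalences `counit c : F (R c) ⟶ c`, the
functors `x ↦ F x ≫ counit c` from `B(b, R c)` to `C(F b, c)` are equivalences. A 1-morphism
`f : c ⟶ d` is therefore lifted to `R f : R c ⟶ R d` together with an invertible square
`F (R f) ≫ counit d ≅ counit c ≫ f`, and a 2-morphism between maps into `R c` is determined by its
effect after passing to `c`. So the coherence laws of `R` follow from those of the pasting
of squares (`BiuniversalArrows.pseudofunctor`), and the squares form a strong transformation
`F R ⟶ 𝟙` (`BiuniversalArrows.counitTrans`). Its whiskering `F R F ⟶ F` lifts along the locally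
fully faithful `F` to `R F ⟶ 𝟙` (`BiuniversalArrows.unitInv`). The components of both
transformations are equivalences, and such a transformation is an equivalence, with inverse
given by mates (`Pseudofunctor.StrongTrans.nonempty_equivalence`).
-/

section Whitehead

open CategoryTheory.Bicategory

/-! ### Squares over a pseudofunctor -/

namespace CategoryTheory.Bicategory

universe w₁ w₂ v₁ v₂ u₁ u₂

variable {B : Type u₁} [Bicategory.{w₁, v₁} B] {C : Type u₂} [Bicategory.{w₂, v₂} C]

/-- Postcomposition with an equivalence is an equivalence of hom-categories. -/
theorem Equivalence.isEquivalence_postcomp {b c : B} (e : b ≌ c) (a : B) :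
    (postcomp a e.hom).IsEquivalence :=
  Functor.IsEquivalence.mk' (postcomp a e.inv)
    (NatIso.ofComponents (fun f => (ρ_ f).symm ≪≫ whiskerLeftIso f e.unit ≪≫ (α_ _ _ _).symm)
      fun {f g} η => by
        change η ≫ (ρ_ g).inv ≫ g ◁ e.unit.hom ≫ (α_ g e.hom e.inv).inv =
          ((ρ_ f).inv ≫ f ◁ e.unit.hom ≫ (α_ f e.hom e.inv).inv) ≫ η ▷ e.hom ▷ e.inv
        rw [rightUnitor_inv_naturality_assoc, ← whisker_exchange_assoc]
        simp)
    (NatIso.ofComponents (fun f => α_ _ _ _ ≪≫ whiskerLeftIso f e.counit ≪≫ ρ_ f)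
      fun {f g} η => by
        change η ▷ e.inv ▷ e.hom ≫ (α_ g e.inv e.hom).hom ≫ g ◁ e.counit.hom ≫ (ρ_ g).hom =
          ((α_ f e.inv e.hom).hom ≫ f ◁ e.counit.hom ≫ (ρ_ f).hom) ≫ η
        rw [associator_naturality_left_assoc, ← whisker_exchange_assoc]
        simp)

variable (F : Pseudofunctor B C)

/-- Pasting of the squares `s : F x ≫ e' ≅ e ≫ f` and `t : F y ≫ e'' ≅ e' ≫ g`, precomposed with
the comparison `F (x ≫ y) ≅ F x ≫ F y`. -/
def sqComp {a b c : B} {a' b' c' : C} {e : F.obj a ⟶ a'} {e' : F.obj b ⟶ b'}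
    {e'' : F.obj c ⟶ c'} {x : a ⟶ b} {y : b ⟶ c} {f : a' ⟶ b'} {g : b' ⟶ c'}
    (s : F.map x ≫ e' ≅ e ≫ f) (t : F.map y ≫ e'' ≅ e' ≫ g) :
    F.map (x ≫ y) ≫ e'' ≅ e ≫ f ≫ g :=
  whiskerRightIso (F.mapComp x y) e'' ≪≫ α_ _ _ _ ≪≫ whiskerLeftIso (F.map x) t ≪≫
    (α_ _ _ _).symm ≪≫ whiskerRightIso s g ≪≫ α_ _ _ _

/-- The identity square on `e`, precomposed with the comparison `F (𝟙 a) ≅ 𝟙 (F a)`. -/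
def sqId {a : B} {a' : C} (e : F.obj a ⟶ a') : F.map (𝟙 a) ≫ e ≅ e ≫ 𝟙 a' :=
  whiskerRightIso (F.mapId a) e ≪≫ λ_ e ≪≫ (ρ_ e).symm

variable {a b c d : B} {a' b' c' d' : C} {e : F.obj a ⟶ a'} {e' : F.obj b ⟶ b'}
    {e'' : F.obj c ⟶ c'} {e₃ : F.obj d ⟶ d'}

/-- The hypothesis says that `p` and `q` form a map of squares from `s` to `s'`; such maps can be
whiskered with a further square. -/
theorem whiskerRight_sqComp {x x' : a ⟶ b} {y : b ⟶ c} {f f' : a' ⟶ b'} {g : b' ⟶ c'}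
    (s : F.map x ≫ e' ≅ e ≫ f) (s' : F.map x' ≫ e' ≅ e ≫ f') (t : F.map y ≫ e'' ≅ e' ≫ g)
    (p : x ⟶ x') (q : f ⟶ f') (h : F.map₂ p ▷ e' ≫ s'.hom = s.hom ≫ e ◁ q) :
    F.map₂ (p ▷ y) ▷ e'' ≫ (sqComp F s' t).hom = (sqComp F s t).hom ≫ e ◁ (q ▷ g) := by
  have h' := congrArg (· ▷ g) h
  simp only [comp_whiskerRight] at h'
  simp only [sqComp, Iso.trans_hom, whiskerRightIso_hom, whiskerLeftIso_hom, Iso.symm_hom,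
    Pseudofunctor.map₂_whisker_right, comp_whiskerRight, Category.assoc]
  simp only [inv_hom_whiskerRight_assoc]
  rw [associator_naturality_left_assoc, ← whisker_exchange_assoc,
    associator_inv_naturality_left_assoc, reassoc_of% h', associator_naturality_middle]

theorem whiskerLeft_sqComp {x : a ⟶ b} {y y' : b ⟶ c} {f : a' ⟶ b'} {g g' : b' ⟶ c'}
    (s : F.map x ≫ e' ≅ e ≫ f) (t : F.map y ≫ e'' ≅ e' ≫ g) (t' : F.map y' ≫ e'' ≅ e' ≫ g')
    (p : y ⟶ y') (q : g ⟶ g') (h : F.map₂ p ▷ e'' ≫ t'.hom = t.hom ≫ e' ◁ q) :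
    F.map₂ (x ◁ p) ▷ e'' ≫ (sqComp F s t').hom = (sqComp F s t).hom ≫ e ◁ (f ◁ q) := by
  have h' := congrArg (F.map x ◁ ·) h
  simp only [whiskerLeft_comp] at h'
  simp only [sqComp, Iso.trans_hom, whiskerRightIso_hom, whiskerLeftIso_hom, Iso.symm_hom,
    Pseudofunctor.map₂_whisker_left, comp_whiskerRight, Category.assoc]
  simp only [inv_hom_whiskerRight_assoc]
  rw [associator_naturality_middle_assoc, reassoc_of% h', associator_inv_naturality_right_assoc,
    whisker_exchange_assoc, associator_naturality_right]

theorem associator_sqComp {x : a ⟶ b} {y : b ⟶ c} {z : c ⟶ d} {f : a' ⟶ b'} {g : b' ⟶ c'}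
    {h : c' ⟶ d'} (s : F.map x ≫ e' ≅ e ≫ f) (t : F.map y ≫ e'' ≅ e' ≫ g)
    (r : F.map z ≫ e₃ ≅ e'' ≫ h) :
    F.map₂ (α_ x y z).hom ▷ e₃ ≫ (sqComp F s (sqComp F t r)).hom =
      (sqComp F (sqComp F s t) r).hom ≫ e ◁ (α_ f g h).hom := by
  simp only [sqComp, Iso.trans_hom, whiskerRightIso_hom, whiskerLeftIso_hom, Iso.symm_hom,
    Pseudofunctor.map₂_associator, comp_whiskerRight, whiskerLeft_comp, Category.assoc]
  simp only [inv_hom_whiskerRight_assoc]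
  calc
    _ = 𝟙 _ ⊗≫ (F.mapComp (x ≫ y) z).hom ▷ e₃ ⊗≫ (F.mapComp x y).hom ▷ F.map z ▷ e₃ ⊗≫
          F.map x ◁ ((F.mapComp y z).inv ≫ (F.mapComp y z).hom) ▷ e₃ ⊗≫
          F.map x ◁ F.map y ◁ r.hom ⊗≫ F.map x ◁ t.hom ▷ h ⊗≫ s.hom ▷ g ▷ h ⊗≫ 𝟙 _ := by
      bicategory
    _ = 𝟙 _ ⊗≫ (F.mapComp (x ≫ y) z).hom ▷ e₃ ⊗≫ ((F.mapComp x y).hom ▷ (F.map z ≫ e₃) ≫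
          (F.map x ≫ F.map y) ◁ r.hom) ⊗≫ F.map x ◁ t.hom ▷ h ⊗≫ s.hom ▷ g ▷ h ⊗≫ 𝟙 _ := by
      rw [Iso.inv_hom_id]
      bicategory
    _ = _ := by
      rw [← whisker_exchange]
      bicategory

theorem leftUnitor_sqComp {x : a ⟶ b} {f : a' ⟶ b'} (s : F.map x ≫ e' ≅ e ≫ f) :
    F.map₂ (λ_ x).hom ▷ e' ≫ s.hom = (sqComp F (sqId F e) s).hom ≫ e ◁ (λ_ f).hom := by
  simp only [sqComp, sqId, Iso.trans_hom, whiskerRightIso_hom, whiskerLeftIso_hom, Iso.symm_hom,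
    Pseudofunctor.map₂_left_unitor, comp_whiskerRight, Category.assoc]
  calc
    _ = 𝟙 _ ⊗≫ (F.mapComp (𝟙 a) x).hom ▷ e' ⊗≫ ((F.mapId a).hom ▷ (F.map x ≫ e') ≫
          𝟙 _ ◁ s.hom) ⊗≫ 𝟙 _ := by
      bicategory
    _ = _ := by
      rw [← whisker_exchange]
      bicategory

theorem rightUnitor_sqComp {x : a ⟶ b} {f : a' ⟶ b'} (s : F.map x ≫ e' ≅ e ≫ f) :
    F.map₂ (ρ_ x).hom ▷ e' ≫ s.hom = (sqComp F s (sqId F e')).hom ≫ e ◁ (ρ_ f).hom := by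
  simp only [sqComp, sqId, Iso.trans_hom, whiskerRightIso_hom, whiskerLeftIso_hom, Iso.symm_hom,
    Pseudofunctor.map₂_right_unitor, comp_whiskerRight, whiskerLeft_comp, Category.assoc]
  bicategory

end CategoryTheory.Bicategory

/-! ### The right biadjoint given by biuniversal arrows -/

namespace CategoryTheory.Bicategory

universe w₁ w₂ v₁ v₂ u₁ u₂

/-- A choice, for every object `c`, of a biuniversal arrow `counit c : F (obj c) ⟶ c` from the
pseudofunctor `F` to `c`. Biuniversality is encoded by the requirement that the functors
`x ↦ F x ≫ counit c` on hom-categories are equivalences. -/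
structure BiuniversalArrows {B : Type u₁} [Bicategory.{w₁, v₁} B] {C : Type u₂}
    [Bicategory.{w₂, v₂} C] (F : Pseudofunctor B C) where
  obj : C → B
  counit (c : C) : F.obj (obj c) ⟶ c
  isEquivalence (b : B) (c : C) :
    (F.mapFunctor b (obj c) ⋙ postcomp (F.obj b) (counit c)).IsEquivalence

namespace BiuniversalArrows

variable {B : Type u₁} [Bicategory.{w₁, v₁} B] {C : Type u₂} [Bicategory.{w₂, v₂} C]
  {F : Pseudofunctor B C} (R : BiuniversalArrows F)

attribute [instance] isEquivalence

/-- The 1-morphism `R c ⟶ R d` classifying `F (R c) ⟶ c ⟶ d`. -/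
noncomputable def map {c d : C} (f : c ⟶ d) : R.obj c ⟶ R.obj d :=
  (F.mapFunctor (R.obj c) (R.obj d) ⋙ postcomp _ (R.counit d)).objPreimage (R.counit c ≫ f)

/-- The square defining `R.map f`. -/
noncomputable def sq {c d : C} (f : c ⟶ d) : F.map (R.map f) ≫ R.counit d ≅ R.counit c ≫ f :=
  (F.mapFunctor (R.obj c) (R.obj d) ⋙ postcomp _ (R.counit d)).objObjPreimageIso (R.counit c ≫ f)

theorem hom₂_ext {b : B} {c : C} {x y : b ⟶ R.obj c} {p q : x ⟶ y}
    (h : F.map₂ p ▷ R.counit c = F.map₂ q ▷ R.counit c) : p = q :=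
  (F.mapFunctor b (R.obj c) ⋙ postcomp _ (R.counit c)).map_injective h

/-- The 2-isomorphism between maps into `R c` given by one after passing to `c`. -/
noncomputable def liftIso {b : B} {c : C} {x y : b ⟶ R.obj c}
    (η : F.map x ≫ R.counit c ≅ F.map y ≫ R.counit c) : x ≅ y :=
  (F.mapFunctor b (R.obj c) ⋙ postcomp _ (R.counit c)).preimageIso η

@[simp]
theorem map_liftIso {b : B} {c : C} {x y : b ⟶ R.obj c}
    (η : F.map x ≫ R.counit c ≅ F.map y ≫ R.counit c) :
    F.map₂ (R.liftIso η).hom ▷ R.counit c = η.hom :=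
  (F.mapFunctor b (R.obj c) ⋙ postcomp _ (R.counit c)).map_preimage η.hom

/-- The 2-morphism `R.map f ⟶ R.map g` corresponding to `R.counit c ◁ η` under the defining
squares of `R.map f` and `R.map g`. -/
noncomputable def map₂ {c d : C} {f g : c ⟶ d} (η : f ⟶ g) : R.map f ⟶ R.map g :=
  (F.mapFunctor (R.obj c) (R.obj d) ⋙ postcomp _ (R.counit d)).preimage
    ((R.sq f).hom ≫ R.counit c ◁ η ≫ (R.sq g).inv)

theorem map₂_sq {c d : C} {f g : c ⟶ d} (η : f ⟶ g) :
    F.map₂ (R.map₂ η) ▷ R.counit d ≫ (R.sq g).hom = (R.sq f).hom ≫ R.counit c ◁ η := by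
  have h : F.map₂ (R.map₂ η) ▷ R.counit d = (R.sq f).hom ≫ R.counit c ◁ η ≫ (R.sq g).inv :=
    (F.mapFunctor (R.obj c) (R.obj d) ⋙ postcomp _ (R.counit d)).map_preimage
      ((R.sq f).hom ≫ R.counit c ◁ η ≫ (R.sq g).inv)
  rw [h]
  simp only [Category.assoc, Iso.inv_hom_id, Category.comp_id]

/-- Two 2-morphisms into `y` agree if they agree after pasting with an invertible square on `y`.
This turns the coherence laws of `R` into identities between pasted squares. -/
theorem hom₂_ext_sq {b : B} {b' c : C} {x y : b ⟶ R.obj c} {e : F.obj b ⟶ b'} {f : b' ⟶ c}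
    (s : F.map y ≫ R.counit c ≅ e ≫ f) {p q : x ⟶ y}
    (h : F.map₂ p ▷ R.counit c ≫ s.hom = F.map₂ q ▷ R.counit c ≫ s.hom) : p = q :=
  R.hom₂_ext ((cancel_mono s.hom).1 h)

/-- The comparison under which `R.sq (𝟙 c)` becomes the identity square. -/
noncomputable def mapId (c : C) : R.map (𝟙 c) ≅ 𝟙 (R.obj c) :=
  R.liftIso (R.sq (𝟙 c) ≪≫ (sqId F (R.counit c)).symm)

theorem mapId_sq (c : C) :
    F.map₂ (R.mapId c).hom ▷ R.counit c ≫ (sqId F (R.counit c)).hom = (R.sq (𝟙 c)).hom := by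
  simp [mapId]

/-- The comparison under which `R.sq (f ≫ g)` becomes the pasting of `R.sq f` and `R.sq g`. -/
noncomputable def mapComp {c d e : C} (f : c ⟶ d) (g : d ⟶ e) :
    R.map (f ≫ g) ≅ R.map f ≫ R.map g :=
  R.liftIso (R.sq (f ≫ g) ≪≫ (sqComp F (R.sq f) (R.sq g)).symm)

theorem mapComp_sq {c d e : C} (f : c ⟶ d) (g : d ⟶ e) :
    F.map₂ (R.mapComp f g).hom ▷ R.counit e ≫ (sqComp F (R.sq f) (R.sq g)).hom =
      (R.sq (f ≫ g)).hom := by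
  simp [mapComp]

theorem map₂_whiskerLeft {c d e : C} (f : c ⟶ d) {g h : d ⟶ e} (η : g ⟶ h) :
    R.map₂ (f ◁ η) ≫ (R.mapComp f h).hom = (R.mapComp f g).hom ≫ R.map f ◁ R.map₂ η := by
  refine R.hom₂_ext_sq (sqComp F (R.sq f) (R.sq h)) ?_
  rw [PrelaxFunctor.map₂_comp, PrelaxFunctor.map₂_comp, comp_whiskerRight, comp_whiskerRight,
    Category.assoc, Category.assoc, mapComp_sq, map₂_sq,
    whiskerLeft_sqComp F (R.sq f) (R.sq g) (R.sq h) _ _ (R.map₂_sq η), ← mapComp_sq,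
    Category.assoc]

theorem map₂_whiskerRight {c d e : C} {f g : c ⟶ d} (η : f ⟶ g) (h : d ⟶ e) :
    R.map₂ (η ▷ h) ≫ (R.mapComp g h).hom = (R.mapComp f h).hom ≫ R.map₂ η ▷ R.map h := by
  refine R.hom₂_ext_sq (sqComp F (R.sq g) (R.sq h)) ?_
  rw [PrelaxFunctor.map₂_comp, PrelaxFunctor.map₂_comp, comp_whiskerRight, comp_whiskerRight,
    Category.assoc, Category.assoc, mapComp_sq, map₂_sq,
    whiskerRight_sqComp F (R.sq f) (R.sq g) (R.sq h) _ _ (R.map₂_sq η), ← mapComp_sq,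
    Category.assoc]

theorem map₂_associator {c₀ c₁ c₂ c₃ : C} (f : c₀ ⟶ c₁) (g : c₁ ⟶ c₂) (h : c₂ ⟶ c₃) :
    R.map₂ (α_ f g h).hom ≫ (R.mapComp f (g ≫ h)).hom ≫ R.map f ◁ (R.mapComp g h).hom =
      (R.mapComp (f ≫ g) h).hom ≫ (R.mapComp f g).hom ▷ R.map h ≫
        (α_ (R.map f) (R.map g) (R.map h)).hom := by
  refine R.hom₂_ext_sq (sqComp F (R.sq f) (sqComp F (R.sq g) (R.sq h))) ?_
  have h₁ := whiskerLeft_sqComp F (R.sq f) (R.sq (g ≫ h)) (sqComp F (R.sq g) (R.sq h))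
    (R.mapComp g h).hom (𝟙 _) (by rw [mapComp_sq]; simp)
  have h₂ := whiskerRight_sqComp F (R.sq (f ≫ g)) (sqComp F (R.sq f) (R.sq g)) (R.sq h)
    (R.mapComp f g).hom (𝟙 _) (by rw [mapComp_sq]; simp)
  have h₃ := R.mapComp_sq f (g ≫ h)
  have h₄ := R.mapComp_sq (f ≫ g) h
  simp only [PrelaxFunctor.map₂_comp, comp_whiskerRight, Category.assoc]
  rw [h₁, associator_sqComp, reassoc_of% h₂, whiskerLeft_id, whiskerLeft_id, Category.comp_id,
    id_whiskerRight, whiskerLeft_id, Category.id_comp, h₃, map₂_sq, reassoc_of% h₄]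

theorem map₂_leftUnitor {c d : C} (f : c ⟶ d) :
    R.map₂ (λ_ f).hom =
      (R.mapComp (𝟙 c) f).hom ≫ (R.mapId c).hom ▷ R.map f ≫ (λ_ (R.map f)).hom := by
  refine R.hom₂_ext_sq (R.sq f) ?_
  have h₂ := whiskerRight_sqComp F (R.sq (𝟙 c)) (sqId F (R.counit c)) (R.sq f)
    (R.mapId c).hom (𝟙 _) (by rw [mapId_sq]; simp)
  have h₄ := R.mapComp_sq (𝟙 c) f
  simp only [PrelaxFunctor.map₂_comp, comp_whiskerRight, Category.assoc]
  rw [leftUnitor_sqComp, reassoc_of% h₂, id_whiskerRight, whiskerLeft_id, Category.id_comp,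
    map₂_sq, reassoc_of% h₄]

theorem map₂_rightUnitor {c d : C} (f : c ⟶ d) :
    R.map₂ (ρ_ f).hom =
      (R.mapComp f (𝟙 d)).hom ≫ R.map f ◁ (R.mapId d).hom ≫ (ρ_ (R.map f)).hom := by
  refine R.hom₂_ext_sq (R.sq f) ?_
  have h₁ := whiskerLeft_sqComp F (R.sq f) (R.sq (𝟙 d)) (sqId F (R.counit d))
    (R.mapId d).hom (𝟙 _) (by rw [mapId_sq]; simp)
  have h₄ := R.mapComp_sq f (𝟙 d)
  simp only [PrelaxFunctor.map₂_comp, comp_whiskerRight, Category.assoc]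
  rw [rightUnitor_sqComp, reassoc_of% h₁, whiskerLeft_id, whiskerLeft_id, Category.id_comp,
    map₂_sq, reassoc_of% h₄]

/-- The right biadjoint of `F` assembled from the biuniversal arrows. -/
noncomputable def pseudofunctor : Pseudofunctor C B where
  obj := R.obj
  map := R.map
  map₂ := R.map₂
  map₂_id f := R.hom₂_ext_sq (R.sq f) (by rw [map₂_sq]; simp)
  map₂_comp {c d f g h} η θ := R.hom₂_ext_sq (R.sq h) (by
    rw [map₂_sq, PrelaxFunctor.map₂_comp, comp_whiskerRight, Category.assoc, map₂_sq,
      ← Category.assoc, map₂_sq]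
    simp)
  mapId := R.mapId
  mapComp := R.mapComp
  map₂_whisker_left f _ _ η := by
    rw [← Category.assoc, Iso.eq_comp_inv]
    exact R.map₂_whiskerLeft f η
  map₂_whisker_right η f := by
    rw [← Category.assoc, Iso.eq_comp_inv]
    exact R.map₂_whiskerRight η f
  map₂_associator f g h := by
    rw [← cancel_mono (R.mapComp f (g ≫ h)).hom, ← cancel_mono (R.map f ◁ (R.mapComp g h).hom)]
    simpa using R.map₂_associator f g h
  map₂_left_unitor f := R.map₂_leftUnitor f
  map₂_right_unitor f := R.map₂_rightUnitor f

/-- The counit of the biadjunction. Its naturality squares are the defining squares `R.sq f`, and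
its axioms are the defining properties of `R.map₂`, `R.mapId` and `R.mapComp`. -/
noncomputable def counitTrans :
    Pseudofunctor.StrongTrans (R.pseudofunctor.comp F) (Pseudofunctor.id C) where
  app := R.counit
  naturality := R.sq
  naturality_naturality η := R.map₂_sq η
  naturality_id c := by
    have h := R.mapId_sq c
    change (R.sq (𝟙 c)).hom ≫ R.counit c ◁ 𝟙 (𝟙 c) =
      (F.map₂ (R.mapId c).hom ≫ (F.mapId (R.obj c)).hom) ▷ R.counit c ≫
        (λ_ (R.counit c)).hom ≫ (ρ_ (R.counit c)).inv
    rw [← h]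
    simp [sqId]
  naturality_comp {c d e} f g := by
    have h := R.mapComp_sq f g
    change (R.sq (f ≫ g)).hom ≫ R.counit c ◁ 𝟙 (f ≫ g) =
      (F.map₂ (R.mapComp f g).hom ≫ (F.mapComp (R.map f) (R.map g)).hom) ▷ R.counit e ≫
        (α_ (F.map (R.map f)) (F.map (R.map g)) (R.counit e)).hom ≫
          F.map (R.map f) ◁ (R.sq g).hom ≫ (α_ (F.map (R.map f)) (R.counit d) g).inv ≫
            (R.sq f).hom ▷ g ≫ (α_ (R.counit c) f g).hom
    rw [← h]
    simp [sqComp]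

end BiuniversalArrows

end CategoryTheory.Bicategory

/-! ### Strong transformations whose components are equivalences -/

namespace CategoryTheory.Bicategory

universe w₁ w₂ v₁ v₂ u₁ u₂

variable {C : Type u₂} [Bicategory.{w₂, v₂} C]

/-- Pasting of two squares along a common vertical 1-morphism. -/
def pasteSq {a b c a' b' c' : C} {p : a ⟶ b} {r : b ⟶ c} {q : a' ⟶ b'} {t : b' ⟶ c'}
    {e : a ⟶ a'} {e' : b ⟶ b'} {e'' : c ⟶ c'} (s : p ≫ e' ≅ e ≫ q) (s' : r ≫ e'' ≅ e' ≫ t) :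
    (p ≫ r) ≫ e'' ≅ e ≫ q ≫ t :=
  α_ _ _ _ ≪≫ whiskerLeftIso p s' ≪≫ (α_ _ _ _).symm ≪≫ whiskerRightIso s t ≪≫ α_ _ _ _

/-- The mate of the inverse of an invertible square `s` whose vertical sides `e` and `e'` have
quasi-inverses `i` and `i'`. -/
def invSq {a b a' b' : C} {p : a ⟶ b} {q : a' ⟶ b'} {e : a ⟶ a'} {e' : b ⟶ b'} {i : a' ⟶ a}
    {i' : b' ⟶ b} (counit : i ≫ e ≅ 𝟙 a') (unit : 𝟙 b ≅ e' ≫ i') (s : p ≫ e' ≅ e ≫ q) :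
    q ≫ i' ≅ i ≫ p :=
  (λ_ _).symm ≪≫ whiskerRightIso counit.symm (q ≫ i') ≪≫ α_ _ _ _ ≪≫
    whiskerLeftIso i ((α_ _ _ _).symm ≪≫ whiskerRightIso s.symm i' ≪≫ α_ _ _ _ ≪≫
      whiskerLeftIso p unit.symm ≪≫ ρ_ p)

theorem invSq_hom {a b a' b' : C} {p : a ⟶ b} {q : a' ⟶ b'} {e : a ⟶ a'} {e' : b ⟶ b'}
    {i : a' ⟶ a} {i' : b' ⟶ b} (counit : i ≫ e ≅ 𝟙 a') (unit : 𝟙 b ≅ e' ≫ i')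
    (s : p ≫ e' ≅ e ≫ q) :
    (invSq counit unit s).hom = (λ_ _).inv ≫ counit.inv ▷ (q ≫ i') ≫ (α_ _ _ _).hom ≫
      i ◁ ((α_ _ _ _).inv ≫ s.inv ▷ i' ≫ (α_ _ _ _).hom ≫ p ◁ unit.inv ≫ (ρ_ p).hom) :=
  rfl

/-- A map of squares from `s` to `s'` gives a map between the mates of their inverses. -/
theorem invSq_naturality {a b a' b' : C} {p p' : a ⟶ b} {q q' : a' ⟶ b'} {e : a ⟶ a'}
    {e' : b ⟶ b'} {i : a' ⟶ a} {i' : b' ⟶ b} (counit : i ≫ e ≅ 𝟙 a') (unit : 𝟙 b ≅ e' ≫ i')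
    (s : p ≫ e' ≅ e ≫ q) (s' : p' ≫ e' ≅ e ≫ q') (φ : p ⟶ p') (ψ : q ⟶ q')
    (h : φ ▷ e' ≫ s'.hom = s.hom ≫ e ◁ ψ) :
    ψ ▷ i' ≫ (invSq counit unit s').hom = (invSq counit unit s).hom ≫ i ◁ φ := by
  have h' : e ◁ ψ ≫ s'.inv = s.inv ≫ φ ▷ e' := by
    rw [Iso.comp_inv_eq, Category.assoc, h, Iso.inv_hom_id_assoc]
  rw [invSq_hom, invSq_hom]
  calc
    _ = 𝟙 _ ⊗≫ (𝟙 a' ◁ (ψ ▷ i') ≫ counit.inv ▷ (q' ≫ i')) ⊗≫ i ◁ s'.inv ▷ i' ⊗≫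
          i ◁ p' ◁ unit.inv ⊗≫ 𝟙 _ := by
      bicategory
    _ = 𝟙 _ ⊗≫ counit.inv ▷ (q ≫ i') ⊗≫ i ◁ (e ◁ ψ ≫ s'.inv) ▷ i' ⊗≫
          i ◁ p' ◁ unit.inv ⊗≫ 𝟙 _ := by
      rw [whisker_exchange]
      bicategory
    _ = 𝟙 _ ⊗≫ counit.inv ▷ (q ≫ i') ⊗≫ i ◁ s.inv ▷ i' ⊗≫
          i ◁ (φ ▷ (e' ≫ i') ≫ p' ◁ unit.inv) ⊗≫ 𝟙 _ := by
      rw [h']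
      bicategory
    _ = _ := by
      rw [← whisker_exchange]
      bicategory

/-- A form of the left triangle identity: `e ◁ counit.inv` and `unit.hom ▷ e` agree up to
coherence, since both invert `e ◁ counit.hom`. -/
theorem whiskerLeft_counit_inv {a a' : C} {e : a ⟶ a'} {i : a' ⟶ a} {unit : 𝟙 a ≅ e ≫ i}
    {counit : i ≫ e ≅ 𝟙 a'} (h : leftZigzag unit.hom counit.hom = (λ_ e).hom ≫ (ρ_ e).inv) :
    e ◁ counit.inv = 𝟙 _ ⊗≫ unit.hom ▷ e ⊗≫ 𝟙 _ := by
  have h' : unit.hom ▷ e ⊗≫ e ◁ counit.hom = (λ_ e).hom ≫ (ρ_ e).inv := h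
  rw [← cancel_mono (e ◁ counit.hom), whiskerLeft_inv_hom]
  calc
    _ = 𝟙 _ ⊗≫ ((λ_ e).hom ≫ (ρ_ e).inv) ⊗≫ 𝟙 _ := by bicategory
    _ = _ := by
      rw [← h']
      bicategory

theorem unit_inv_whiskerRight {a a' : C} {e : a ⟶ a'} {i : a' ⟶ a} {unit : 𝟙 a ≅ e ≫ i}
    {counit : i ≫ e ≅ 𝟙 a'} (h : leftZigzag unit.hom counit.hom = (λ_ e).hom ≫ (ρ_ e).inv) :
    unit.inv ▷ e = 𝟙 _ ⊗≫ e ◁ counit.hom ⊗≫ 𝟙 _ := by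
  have h' : unit.hom ▷ e ⊗≫ e ◁ counit.hom = (λ_ e).hom ≫ (ρ_ e).inv := h
  rw [← cancel_epi (unit.hom ▷ e), hom_inv_whiskerRight]
  calc
    _ = 𝟙 _ ⊗≫ ((λ_ e).hom ≫ (ρ_ e).inv) ⊗≫ 𝟙 _ := by bicategory
    _ = _ := by
      rw [← h']
      bicategory

theorem invSq_pasteSq {a b c a' b' c' : C} {p : a ⟶ b} {r : b ⟶ c} {q : a' ⟶ b'} {t : b' ⟶ c'}
    {e : a ⟶ a'} {e' : b ⟶ b'} {e'' : c ⟶ c'} {i : a' ⟶ a} {i' : b' ⟶ b} {i'' : c' ⟶ c}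
    (counit : i ≫ e ≅ 𝟙 a') (unit' : 𝟙 b ≅ e' ≫ i') (counit' : i' ≫ e' ≅ 𝟙 b')
    (unit'' : 𝟙 c ≅ e'' ≫ i'')
    (h : leftZigzag unit'.hom counit'.hom = (λ_ e').hom ≫ (ρ_ e').inv)
    (s : p ≫ e' ≅ e ≫ q) (s' : r ≫ e'' ≅ e' ≫ t) :
    invSq counit unit'' (pasteSq s s') =
      pasteSq (invSq counit unit' s) (invSq counit' unit'' s') := by
  ext
  symm
  simp only [pasteSq, invSq_hom, Iso.trans_hom, Iso.trans_inv, whiskerRightIso_hom,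
    whiskerLeftIso_hom, whiskerRightIso_inv, whiskerLeftIso_inv, Iso.symm_hom, Iso.symm_inv]
  -- The middle counit and unit are brought next to each other by interchange; then they cancel
  -- by the triangle identity.
  calc
    _ = 𝟙 _ ⊗≫ q ◁ counit'.inv ▷ (t ≫ i'') ⊗≫
          ((q ≫ i') ◁ (𝟙 (e' ≫ t ≫ i'') ⊗≫ s'.inv ▷ i'' ⊗≫ r ◁ unit''.inv ⊗≫ 𝟙 r) ≫
          (𝟙 (q ≫ i') ⊗≫ counit.inv ▷ (q ≫ i') ⊗≫ i ◁ s.inv ▷ i' ⊗≫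
            i ◁ p ◁ unit'.inv ⊗≫ 𝟙 (i ≫ p)) ▷ r) ⊗≫ 𝟙 _ := by
      bicategory
    _ = 𝟙 _ ⊗≫ ((𝟙 a' ≫ q) ◁ counit'.inv ▷ (t ≫ i'') ≫
          (counit.inv ▷ q) ▷ ((i' ≫ e') ≫ t ≫ i'')) ⊗≫
          i ◁ s.inv ▷ (i' ≫ e' ≫ t ≫ i'') ⊗≫ i ◁ p ◁ unit'.inv ▷ (e' ≫ t ≫ i'') ⊗≫
          i ◁ p ◁ s'.inv ▷ i'' ⊗≫ i ◁ p ◁ r ◁ unit''.inv ⊗≫ 𝟙 _ := by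
      rw [whisker_exchange]
      bicategory
    _ = 𝟙 _ ⊗≫ counit.inv ▷ (q ≫ t ≫ i'') ⊗≫
          i ◁ ((e ≫ q) ◁ counit'.inv ≫ s.inv ▷ (i' ≫ e')) ▷ (t ≫ i'') ⊗≫
          i ◁ p ◁ unit'.inv ▷ (e' ≫ t ≫ i'') ⊗≫
          i ◁ p ◁ s'.inv ▷ i'' ⊗≫ i ◁ p ◁ r ◁ unit''.inv ⊗≫ 𝟙 _ := by
      rw [whisker_exchange]
      bicategory
    _ = 𝟙 _ ⊗≫ counit.inv ▷ (q ≫ t ≫ i'') ⊗≫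
          i ◁ s.inv ▷ (t ≫ i'') ⊗≫ i ◁ p ◁ (e' ◁ counit'.inv) ▷ (t ≫ i'') ⊗≫
          i ◁ p ◁ (unit'.inv ▷ e') ▷ (t ≫ i'') ⊗≫
          i ◁ p ◁ s'.inv ▷ i'' ⊗≫ i ◁ p ◁ r ◁ unit''.inv ⊗≫ 𝟙 _ := by
      rw [whisker_exchange]
      bicategory
    _ = 𝟙 _ ⊗≫ counit.inv ▷ (q ≫ t ≫ i'') ⊗≫
          i ◁ s.inv ▷ (t ≫ i'') ⊗≫ i ◁ p ◁ ((unit'.hom ≫ unit'.inv) ▷ e') ▷ (t ≫ i'') ⊗≫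
          i ◁ p ◁ s'.inv ▷ i'' ⊗≫ i ◁ p ◁ r ◁ unit''.inv ⊗≫ 𝟙 _ := by
      rw [whiskerLeft_counit_inv h]
      bicategory
    _ = _ := by
      rw [Iso.hom_inv_id]
      bicategory

/-- This is the right triangle identity. -/
theorem invSq_id {a a' : C} {e : a ⟶ a'} {i : a' ⟶ a} (counit : i ≫ e ≅ 𝟙 a')
    (unit : 𝟙 a ≅ e ≫ i) (h : leftZigzag unit.hom counit.hom = (λ_ e).hom ≫ (ρ_ e).inv) :
    invSq counit unit (λ_ e ≪≫ (ρ_ e).symm) = λ_ i ≪≫ (ρ_ i).symm := by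
  have h₁ : rightZigzag unit.hom counit.hom = (ρ_ i).hom ≫ (λ_ i).inv :=
    right_triangle_of_left_triangle unit counit h
  have h₂ : rightZigzagIso unit counit = ρ_ i ≪≫ (λ_ i).symm := Iso.ext h₁
  have h₃ : counit.inv ▷ i ⊗≫ i ◁ unit.inv = (λ_ i).hom ≫ (ρ_ i).inv := by
    have h₄ := congrArg Iso.inv h₂
    rw [rightZigzagIso_inv] at h₄
    exact h₄
  ext
  simp only [invSq_hom, Iso.trans_hom, Iso.trans_inv, Iso.symm_hom, Iso.symm_inv]
  rw [← h₃]
  bicategory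

/-- The unit is compatible with the pasting of `s` and its inverse: this makes it a modification. -/
theorem unit_pasteSq {a b a' b' : C} {p : a ⟶ b} {q : a' ⟶ b'} {e : a ⟶ a'} {e' : b ⟶ b'}
    {i : a' ⟶ a} {i' : b' ⟶ b} (unit : 𝟙 a ≅ e ≫ i) (counit : i ≫ e ≅ 𝟙 a')
    (unit' : 𝟙 b ≅ e' ≫ i')
    (h : leftZigzag unit.hom counit.hom = (λ_ e).hom ≫ (ρ_ e).inv) (s : p ≫ e' ≅ e ≫ q) :
    p ◁ unit'.hom ≫ (α_ _ _ _).inv ≫ s.hom ▷ i' ≫ (α_ _ _ _).hom ≫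
      e ◁ (invSq counit unit' s).hom ≫ (α_ _ _ _).inv = (ρ_ p).hom ≫ (λ_ p).inv ≫
        unit.hom ▷ p := by
  rw [invSq_hom]
  calc
    _ = 𝟙 _ ⊗≫ p ◁ unit'.hom ⊗≫ s.hom ▷ i' ⊗≫ (e ◁ counit.inv) ▷ (q ≫ i') ⊗≫
          e ◁ i ◁ s.inv ▷ i' ⊗≫ e ◁ i ◁ p ◁ unit'.inv ⊗≫ 𝟙 _ := by
      bicategory
    _ = 𝟙 _ ⊗≫ p ◁ unit'.hom ⊗≫ s.hom ▷ i' ⊗≫ (unit.hom ▷ ((e ≫ q) ≫ i') ≫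
          (e ≫ i) ◁ (s.inv ▷ i' ⊗≫ p ◁ unit'.inv)) ⊗≫ 𝟙 _ := by
      rw [whiskerLeft_counit_inv h]
      bicategory
    _ = 𝟙 _ ⊗≫ p ◁ unit'.hom ⊗≫ (s.hom ≫ s.inv) ▷ i' ⊗≫ p ◁ unit'.inv ⊗≫
          unit.hom ▷ p ⊗≫ 𝟙 _ := by
      rw [← whisker_exchange]
      bicategory
    _ = 𝟙 _ ⊗≫ p ◁ (unit'.hom ≫ unit'.inv) ⊗≫ unit.hom ▷ p ⊗≫ 𝟙 _ := by
      rw [Iso.hom_inv_id]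
      bicategory
    _ = _ := by
      rw [Iso.hom_inv_id]
      bicategory

/-- The counit is compatible with the pasting of the inverse of `s` and `s`. -/
theorem counit_pasteSq {a b a' b' : C} {p : a ⟶ b} {q : a' ⟶ b'} {e : a ⟶ a'} {e' : b ⟶ b'}
    {i : a' ⟶ a} {i' : b' ⟶ b} (counit : i ≫ e ≅ 𝟙 a')
    (unit' : 𝟙 b ≅ e' ≫ i') (counit' : i' ≫ e' ≅ 𝟙 b')
    (h : leftZigzag unit'.hom counit'.hom = (λ_ e').hom ≫ (ρ_ e').inv) (s : p ≫ e' ≅ e ≫ q) :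
    q ◁ counit'.hom ≫ (ρ_ q).hom ≫ (λ_ q).inv = ((α_ _ _ _).inv ≫
      (invSq counit unit' s).hom ▷ e' ≫ (α_ _ _ _).hom ≫ i ◁ s.hom ≫ (α_ _ _ _).inv) ≫
        counit.hom ▷ q := by
  rw [invSq_hom]
  symm
  calc
    _ = 𝟙 _ ⊗≫ counit.inv ▷ (q ≫ i' ≫ e') ⊗≫ i ◁ s.inv ▷ (i' ≫ e') ⊗≫
          i ◁ p ◁ (unit'.inv ▷ e') ⊗≫ i ◁ s.hom ⊗≫ counit.hom ▷ q ⊗≫ 𝟙 _ := by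
      bicategory
    _ = 𝟙 _ ⊗≫ counit.inv ▷ (q ≫ i' ≫ e') ⊗≫ i ◁ (s.inv ▷ (i' ≫ e') ≫
          (p ≫ e') ◁ counit'.hom) ⊗≫ i ◁ s.hom ⊗≫ counit.hom ▷ q ⊗≫ 𝟙 _ := by
      rw [unit_inv_whiskerRight h]
      bicategory
    _ = 𝟙 _ ⊗≫ (counit.inv ▷ (q ≫ i' ≫ e') ≫ (i ≫ e) ◁ q ◁ counit'.hom) ⊗≫
          i ◁ (s.inv ≫ s.hom) ⊗≫ counit.hom ▷ q ⊗≫ 𝟙 _ := by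
      rw [← whisker_exchange]
      bicategory
    _ = 𝟙 _ ⊗≫ q ◁ counit'.hom ⊗≫ (counit.inv ≫ counit.hom) ▷ q ⊗≫ 𝟙 _ := by
      rw [← whisker_exchange, Iso.inv_hom_id]
      bicategory
    _ = _ := by
      rw [Iso.inv_hom_id]
      bicategory

end CategoryTheory.Bicategory

namespace CategoryTheory.Pseudofunctor.StrongTrans


universe w₁ w₂ v₁ v₂ u₁ u₂

variable {B : Type u₁} [Bicategory.{w₁, v₁} B] {C : Type u₂} [Bicategory.{w₂, v₂} C]
  {P Q : Pseudofunctor B C}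

/-- The strong transformation formed by componentwise adjoint inverses; its naturality squares are
the mates of the inverses of those of `η`. -/
def inverse (η : StrongTrans P Q) (inv : ∀ b, Q.obj b ⟶ P.obj b)
    (unit : ∀ b, 𝟙 (P.obj b) ≅ η.app b ≫ inv b) (counit : ∀ b, inv b ≫ η.app b ≅ 𝟙 (Q.obj b))
    (h : ∀ b, leftZigzag (unit b).hom (counit b).hom = (λ_ (η.app b)).hom ≫ (ρ_ (η.app b)).inv) :
    StrongTrans Q P where
  app := inv
  naturality {a b} f := invSq (counit a) (unit b) (η.naturality f)
  naturality_naturality θ := invSq_naturality _ _ _ _ _ _ (η.naturality_naturality θ)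
  naturality_id a := by
    rw [← invSq_naturality _ _ (η.naturality (𝟙 a)) (λ_ (η.app a) ≪≫ (ρ_ (η.app a)).symm)
      (P.mapId a).hom (Q.mapId a).hom (η.naturality_id a).symm, invSq_id _ _ (h a)]
    rfl
  naturality_comp {a b c} f g := by
    rw [← invSq_naturality _ _ (η.naturality (f ≫ g))
      (pasteSq (η.naturality f) (η.naturality g)) (P.mapComp f g).hom (Q.mapComp f g).hom
      (η.naturality_comp f g).symm, invSq_pasteSq _ _ _ _ (h b)]
    rfl

/-- A strong transformation whose components are equivalences is an equivalence. -/
theorem nonempty_equivalence (η : P ⟶ Q)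
    (h : ∀ b, ∃ i : Q.obj b ⟶ P.obj b, Nonempty (𝟙 (P.obj b) ≅ η.app b ≫ i) ∧
      Nonempty (i ≫ η.app b ≅ 𝟙 (Q.obj b))) : Nonempty (P ≌ Q) := by
  choose inv hu hc using h
  let unit b := (hu b).some
  -- The mates satisfy the axioms only for adjoint equivalences, so the counit is corrected first.
  let counit b := Bicategory.adjointifyCounit (unit b) (hc b).some
  have tri b : leftZigzag (unit b).hom (counit b).hom =
      (λ_ (η.app b)).hom ≫ (ρ_ (η.app b)).inv :=
    congrArg Iso.hom (Bicategory.adjointifyCounit_left_triangle (unit b) (hc b).some)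
  let θ : Q ⟶ P := inverse η inv unit counit tri
  let u : 𝟙 P ≅ η ≫ θ := isoMk unit fun {a b} f => by
    have := unit_pasteSq (unit a) (counit a) (unit b) (tri a) (η.naturality f)
    exact this.trans (Category.assoc _ _ _).symm
  let c : θ ≫ η ≅ 𝟙 Q := isoMk counit fun {a b} f => by
    have := counit_pasteSq (counit a) (unit b) (counit b) (tri b) (η.naturality f)
    refine this.trans ?_
    refine congrArg (· ≫ (counit a).hom ▷ Q.map f) ?_
    rfl
  exact ⟨Bicategory.Equivalence.mkOfAdjointifyCounit u c⟩

end CategoryTheory.Pseudofunctor.StrongTrans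

/-! ### Lifting transformations along a locally fully faithful pseudofunctor -/

namespace CategoryTheory.Pseudofunctor

universe w₁ w₂ w₃ v₁ v₂ v₃ u₁ u₂ u₃

variable {B : Type u₁} [Bicategory.{w₁, v₁} B] {C : Type u₂} [Bicategory.{w₂, v₂} C]
  (F : Pseudofunctor B C)

/-- The image under `F` of the square `ν`, with the vertical sides `F x` and `F y` replaced by
isomorphic 1-morphisms `X` and `Y`. -/
def mapSq {a b a' b' : B} {p : a ⟶ b} {q : a' ⟶ b'} {x : a ⟶ a'} {y : b ⟶ b'}
    {X : F.obj a ⟶ F.obj a'} {Y : F.obj b ⟶ F.obj b'} (β : F.map x ≅ X) (γ : F.map y ≅ Y)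
    (ν : p ≫ y ⟶ x ≫ q) : F.map p ≫ Y ⟶ X ≫ F.map q :=
  F.map p ◁ γ.inv ≫ (F.mapComp p y).inv ≫ F.map₂ ν ≫ (F.mapComp x q).hom ≫ β.hom ▷ F.map q

/-- The preimage under `mapSq` of an invertible square, for a locally fully faithful
pseudofunctor. -/
noncomputable def liftSq [∀ a b, (F.mapFunctor a b).Full] [∀ a b, (F.mapFunctor a b).Faithful]
    {a b a' b' : B} {p : a ⟶ b} {q : a' ⟶ b'} {x : a ⟶ a'} {y : b ⟶ b'}
    {X : F.obj a ⟶ F.obj a'} {Y : F.obj b ⟶ F.obj b'} (β : F.map x ≅ X) (γ : F.map y ≅ Y)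
    (s : F.map p ≫ Y ≅ X ≫ F.map q) : p ≫ y ≅ x ≫ q :=
  (F.mapFunctor a b').preimageIso (F.mapComp p y ≪≫ whiskerLeftIso (F.map p) γ ≪≫ s ≪≫
    whiskerRightIso β.symm (F.map q) ≪≫ (F.mapComp x q).symm)

theorem mapSq_liftSq [∀ a b, (F.mapFunctor a b).Full] [∀ a b, (F.mapFunctor a b).Faithful]
    {a b a' b' : B} {p : a ⟶ b} {q : a' ⟶ b'} {x : a ⟶ a'} {y : b ⟶ b'}
    {X : F.obj a ⟶ F.obj a'} {Y : F.obj b ⟶ F.obj b'} (β : F.map x ≅ X) (γ : F.map y ≅ Y)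
    (s : F.map p ≫ Y ≅ X ≫ F.map q) : F.mapSq β γ (F.liftSq β γ s).hom = s.hom := by
  have h : F.map₂ (F.liftSq β γ s).hom = (F.mapComp p y).hom ≫ F.map p ◁ γ.hom ≫ s.hom ≫
      β.inv ▷ F.map q ≫ (F.mapComp x q).inv :=
    (F.mapFunctor a b').map_preimage _
  rw [mapSq, h]
  simp

theorem mapSq_injective [∀ a b, (F.mapFunctor a b).Faithful]
    {a b a' b' : B} {p : a ⟶ b} {q : a' ⟶ b'} {x : a ⟶ a'} {y : b ⟶ b'}
    {X : F.obj a ⟶ F.obj a'} {Y : F.obj b ⟶ F.obj b'} (β : F.map x ≅ X) (γ : F.map y ≅ Y) :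
    Function.Injective (F.mapSq (p := p) (q := q) β γ) := by
  intro ν ν' h
  apply (F.mapFunctor a b').map_injective
  change F.map₂ ν = F.map₂ ν'
  rw [mapSq, mapSq, cancel_epi, cancel_epi] at h
  exact (cancel_mono ((F.mapComp x q).hom ≫ β.hom ▷ F.map q)).1 h

theorem mapSq_comp_whiskerLeft {a b a' b' : B} {p : a ⟶ b} {q q' : a' ⟶ b'} {x : a ⟶ a'}
    {y : b ⟶ b'} {X : F.obj a ⟶ F.obj a'} {Y : F.obj b ⟶ F.obj b'} (β : F.map x ≅ X)
    (γ : F.map y ≅ Y) (ν : p ≫ y ⟶ x ≫ q) (ψ : q ⟶ q') :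
    F.mapSq β γ (ν ≫ x ◁ ψ) = F.mapSq β γ ν ≫ X ◁ F.map₂ ψ := by
  simp [mapSq, whisker_exchange]

theorem mapSq_whiskerRight_comp {a b a' b' : B} {p p' : a ⟶ b} {q : a' ⟶ b'} {x : a ⟶ a'}
    {y : b ⟶ b'} {X : F.obj a ⟶ F.obj a'} {Y : F.obj b ⟶ F.obj b'} (β : F.map x ≅ X)
    (γ : F.map y ≅ Y) (ν : p' ≫ y ⟶ x ≫ q) (φ : p ⟶ p') :
    F.mapSq β γ (φ ▷ y ≫ ν) = F.map₂ φ ▷ Y ≫ F.mapSq β γ ν := by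
  simp [mapSq, whisker_exchange_assoc]

theorem mapSq_unitors {a a' : B} {x : a ⟶ a'} {X : F.obj a ⟶ F.obj a'} (β : F.map x ≅ X) :
    F.mapSq β β ((λ_ x).hom ≫ (ρ_ x).inv) ≫ X ◁ (F.mapId a').hom =
      (F.mapId a).hom ▷ X ≫ (λ_ X).hom ≫ (ρ_ X).inv := by
  have h : F.map₂ (ρ_ x).inv ≫ (F.mapComp x (𝟙 a')).hom =
      (ρ_ (F.map x)).inv ≫ F.map x ◁ (F.mapId a').inv := by
    rw [F.mapComp_id_right_hom, ← Category.assoc, ← PrelaxFunctor.map₂_comp, Iso.inv_hom_id,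
      PrelaxFunctor.map₂_id, Category.id_comp]
  simp only [mapSq, PrelaxFunctor.map₂_comp, map₂_left_unitor, Category.assoc,
    Iso.inv_hom_id_assoc]
  rw [reassoc_of% h, ← whisker_exchange, whisker_exchange_assoc]
  simp

theorem mapSq_paste {a b c a' b' c' : B} {p : a ⟶ b} {r : b ⟶ c} {q : a' ⟶ b'} {t : b' ⟶ c'}
    {x : a ⟶ a'} {y : b ⟶ b'} {z : c ⟶ c'} {X : F.obj a ⟶ F.obj a'} {Y : F.obj b ⟶ F.obj b'}
    {Z : F.obj c ⟶ F.obj c'} (β : F.map x ≅ X) (γ : F.map y ≅ Y) (δ : F.map z ≅ Z)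
    (ν : p ≫ y ⟶ x ≫ q) (ν' : r ≫ z ⟶ y ≫ t) :
    F.mapSq β δ ((α_ _ _ _).hom ≫ p ◁ ν' ≫ (α_ _ _ _).inv ≫ ν ▷ t ≫ (α_ _ _ _).hom) ≫
        X ◁ (F.mapComp q t).hom =
      (F.mapComp p r).hom ▷ Z ≫ (α_ _ _ _).hom ≫ F.map p ◁ F.mapSq γ δ ν' ≫ (α_ _ _ _).inv ≫
        F.mapSq β γ ν ▷ F.map t ≫ (α_ _ _ _).hom := by
  have h₁ : F.map₂ (α_ p y t).inv ≫ (F.mapComp (p ≫ y) t).hom ≫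
      (F.mapComp p y).hom ▷ F.map t = (F.mapComp p (y ≫ t)).hom ≫
        F.map p ◁ (F.mapComp y t).hom ≫ (α_ _ _ _).inv := by
    rw [F.mapComp_assoc_left_hom, ← Category.assoc, ← PrelaxFunctor.map₂_comp, Iso.inv_hom_id,
      PrelaxFunctor.map₂_id, Category.id_comp]
  have h₂ : F.map₂ (α_ p y t).inv = (F.mapComp p (y ≫ t)).hom ≫
        F.map p ◁ (F.mapComp y t).hom ≫ (α_ _ _ _).inv ≫ (F.mapComp p y).inv ▷ F.map t ≫
          (F.mapComp (p ≫ y) t).inv := by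
    rw [← cancel_mono ((F.mapComp (p ≫ y) t).hom ≫ (F.mapComp p y).hom ▷ F.map t), h₁]
    simp
  simp only [mapSq, PrelaxFunctor.map₂_comp, map₂_associator, map₂_whisker_left,
    map₂_whisker_right, h₂, Category.assoc, Iso.inv_hom_id_assoc, whiskerLeft_comp,
    comp_whiskerRight]
  rw [← whisker_exchange, whisker_exchange_assoc, associator_inv_naturality_middle_assoc]
  simp

variable {D : Type u₃} [Bicategory.{w₃, v₃} D] {B : Type u₁} [Bicategory.{w₁, v₁} B]
  {C : Type u₂} [Bicategory.{w₂, v₂} C] (F : Pseudofunctor B C)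

/-- A strong transformation `P ⋙ F ⟶ Q ⋙ F`, given by components `X` and squares `s`, lifts to
`P ⟶ Q` along a locally fully faithful `F` if its components are in the image of `F` up to
isomorphism. -/
noncomputable def StrongTrans.lift [∀ a b, (F.mapFunctor a b).Full]
    [∀ a b, (F.mapFunctor a b).Faithful] {P Q : Pseudofunctor D B}
    (X : ∀ d, F.obj (P.obj d) ⟶ F.obj (Q.obj d))
    (s : ∀ {a b : D} (f : a ⟶ b), F.map (P.map f) ≫ X b ≅ X a ≫ F.map (Q.map f))
    (s_naturality : ∀ {a b : D} {f g : a ⟶ b} (φ : f ⟶ g),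
      F.map₂ (P.map₂ φ) ▷ X b ≫ (s g).hom = (s f).hom ≫ X a ◁ F.map₂ (Q.map₂ φ))
    (s_id : ∀ a, (s (𝟙 a)).hom ≫ X a ◁ (F.map₂ (Q.mapId a).hom ≫ (F.mapId _).hom) =
      (F.map₂ (P.mapId a).hom ≫ (F.mapId _).hom) ▷ X a ≫ (λ_ (X a)).hom ≫ (ρ_ (X a)).inv)
    (s_comp : ∀ {a b c : D} (f : a ⟶ b) (g : b ⟶ c), (s (f ≫ g)).hom ≫
        X a ◁ (F.map₂ (Q.mapComp f g).hom ≫ (F.mapComp _ _).hom) =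
      (F.map₂ (P.mapComp f g).hom ≫ (F.mapComp _ _).hom) ▷ X c ≫ (α_ _ _ _).hom ≫
        F.map (P.map f) ◁ (s g).hom ≫ (α_ _ _ _).inv ≫
          (s f).hom ▷ F.map (Q.map g) ≫ (α_ _ _ _).hom)
    (x : ∀ d, P.obj d ⟶ Q.obj d) (β : ∀ d, F.map (x d) ≅ X d) : StrongTrans P Q where
  app := x
  naturality {a b} f := F.liftSq (β a) (β b) (s f)
  naturality_naturality {a b f g} φ := by
    apply F.mapSq_injective (β a) (β b)
    rw [mapSq_whiskerRight_comp, mapSq_comp_whiskerLeft, mapSq_liftSq, mapSq_liftSq]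
    exact s_naturality φ
  naturality_id a := by
    apply F.mapSq_injective (β a) (β a)
    have h := s_id a
    rw [mapSq_whiskerRight_comp, mapSq_comp_whiskerLeft, mapSq_liftSq,
      ← cancel_mono (X a ◁ (F.mapId (Q.obj a)).hom), Category.assoc, Category.assoc,
      mapSq_unitors, ← whiskerLeft_comp]
    rw [comp_whiskerRight, Category.assoc] at h
    exact h
  naturality_comp {a b c} f g := by
    apply F.mapSq_injective (β a) (β c)
    have h := s_comp f g
    rw [mapSq_whiskerRight_comp, mapSq_comp_whiskerLeft, mapSq_liftSq,
      ← cancel_mono (X a ◁ (F.mapComp (Q.map f) (Q.map g)).hom), Category.assoc,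
      Category.assoc, mapSq_paste F (β a) (β b) (β c), mapSq_liftSq, mapSq_liftSq,
      ← whiskerLeft_comp]
    rw [comp_whiskerRight, Category.assoc] at h
    exact h

end CategoryTheory.Pseudofunctor

namespace CategoryTheory.Bicategory.BiuniversalArrows

universe w₁ w₂ v₁ v₂ u₁ u₂

variable {B : Type u₁} [Bicategory.{w₁, v₁} B] {C : Type u₂} [Bicategory.{w₂, v₂} C]
  {F : Pseudofunctor B C} (R : BiuniversalArrows F)

/-- The transformation `F ⋙ R ⟶ 𝟙` obtained by lifting the counit, whiskered with `F`, along a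
locally fully faithful `F`. -/
noncomputable def unitInv [∀ a b, (F.mapFunctor a b).Full]
    [∀ a b, (F.mapFunctor a b).Faithful] (x : ∀ b, R.obj (F.obj b) ⟶ b)
    (β : ∀ b, F.map (x b) ≅ R.counit (F.obj b)) :
    Pseudofunctor.StrongTrans (F.comp R.pseudofunctor) (Pseudofunctor.id B) := by
  refine Pseudofunctor.StrongTrans.lift F (P := F.comp R.pseudofunctor) (Q := Pseudofunctor.id B)
    (fun b => R.counit (F.obj b)) (fun f => R.sq (F.map f)) (fun η => R.map₂_sq (F.map₂ η))
    (fun b => ?_) (fun {a b c} f g => ?_) x β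
  · change (R.sq (F.map (𝟙 b))).hom ≫ R.counit (F.obj b) ◁ (F.map₂ (𝟙 (𝟙 b)) ≫ (F.mapId b).hom) =
      (F.map₂ (R.map₂ (F.mapId b).hom ≫ (R.mapId (F.obj b)).hom) ≫
        (F.mapId (R.obj (F.obj b))).hom) ▷ R.counit (F.obj b) ≫
          (λ_ (R.counit (F.obj b))).hom ≫ (ρ_ (R.counit (F.obj b))).inv
    have h₁ := R.map₂_sq (F.mapId b).hom
    have h₂ := R.mapId_sq (F.obj b)
    rw [← h₂] at h₁
    rw [PrelaxFunctor.map₂_id, Category.id_comp, ← h₁]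
    simp [sqId]
  · change (R.sq (F.map (f ≫ g))).hom ≫
        R.counit (F.obj a) ◁ (F.map₂ (𝟙 (f ≫ g)) ≫ (F.mapComp f g).hom) =
      (F.map₂ (R.map₂ (F.mapComp f g).hom ≫ (R.mapComp (F.map f) (F.map g)).hom) ≫
        (F.mapComp (R.map (F.map f)) (R.map (F.map g))).hom) ▷ R.counit (F.obj c) ≫
        (α_ (F.map (R.map (F.map f))) (F.map (R.map (F.map g))) (R.counit (F.obj c))).hom ≫
          F.map (R.map (F.map f)) ◁ (R.sq (F.map g)).hom ≫
            (α_ (F.map (R.map (F.map f))) (R.counit (F.obj b)) (F.map g)).inv ≫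
            (R.sq (F.map f)).hom ▷ F.map g ≫ (α_ (R.counit (F.obj a)) (F.map f) (F.map g)).hom
    have h₁ := R.map₂_sq (F.mapComp f g).hom
    have h₂ := R.mapComp_sq (F.map f) (F.map g)
    rw [← h₂] at h₁
    rw [PrelaxFunctor.map₂_id, Category.id_comp, ← h₁]
    simp [sqComp]

end CategoryTheory.Bicategory.BiuniversalArrows

/-! ### The Whitehead theorem and full sub-bicategories -/

/-- The Whitehead theorem for bicategories: a pseudofunctor that is an equivalence on
hom-categories and surjective on objects up to equivalence is a biequivalence. -/
theorem isBiequivalence_of_isEquivalence_mapFunctor.{w₁, w₂, v₁, v₂, u₁, u₂} {B : Type u₁}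
    [Bicategory.{w₁, v₁} B] {C : Type u₂} [Bicategory.{w₂, v₂} C] (F : Pseudofunctor B C)
    (hF : ∀ a b, (F.mapFunctor a b).IsEquivalence)
    (hobj : ∀ c, ∃ b, Nonempty (Bicategory.Equivalence (F.obj b) c)) : IsBiequivalence F := by
  choose r hr using hobj
  let e c := (hr c).some
  let R : BiuniversalArrows F :=
    { obj := r
      counit := fun c => (e c).hom
      isEquivalence := fun b c =>
        haveI := (e c).isEquivalence_postcomp (F.obj b)
        inferInstance }
  have := fun a b => (hF a b).full
  have := fun a b => (hF a b).faithful
  refine ⟨R.pseudofunctor, ?_, ?_⟩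
  · -- The components of the counit at `F b` are equivalences in the image of `F`, and `F` reflects
    -- equivalences.
    have hη b : ∃ (x : r (F.obj b) ⟶ b), Nonempty (F.map x ≅ (e (F.obj b)).hom) :=
      ⟨_, ⟨(F.mapFunctor (r (F.obj b)) b).objObjPreimageIso (e (F.obj b)).hom⟩⟩
    choose x hx using hη
    let β b := (hx b).some
    refine Pseudofunctor.StrongTrans.nonempty_equivalence
      (R.unitInv x β) fun b => ?_
    obtain ⟨y, ⟨γ⟩⟩ : ∃ y : b ⟶ r (F.obj b), Nonempty (F.map y ≅ (e (F.obj b)).inv) :=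
      ⟨_, ⟨(F.mapFunctor b (r (F.obj b))).objObjPreimageIso (e (F.obj b)).inv⟩⟩
    refine ⟨y, ⟨(F.mapFunctor _ _).preimageIso ?_⟩, ⟨(F.mapFunctor _ _).preimageIso ?_⟩⟩
    · exact F.mapId _ ≪≫ (e (F.obj b)).unit ≪≫ whiskerRightIso (β b).symm _ ≪≫
        whiskerLeftIso _ γ.symm ≪≫ (F.mapComp (x b) y).symm
    · exact F.mapComp y (x b) ≪≫ whiskerRightIso γ _ ≪≫ whiskerLeftIso _ (β b) ≪≫
        (e (F.obj b)).counit ≪≫ (F.mapId b).symm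
  · exact Pseudofunctor.StrongTrans.nonempty_equivalence R.counitTrans fun c =>
      ⟨(e c).inv, ⟨(e c).unit⟩, ⟨(e c).counit⟩⟩

theorem isEquivalence_restrictFull.{w₁, w₂, v₁, v₂, u₁, u₂} {B : Type u₁}
    [Bicategory.{w₁, v₁} B] {C : Type u₂} [Bicategory.{w₂, v₂} C] (F : Pseudofunctor B C)
    (P : Set B) (Q : Set C) (h : ∀ b ∈ P, F.obj b ∈ Q) (a b : FullSub P)
    (hF : (F.mapFunctor a.1 b.1).IsEquivalence) :
    ((restrictFull F P Q h).mapFunctor a b).IsEquivalence where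
  faithful := ⟨fun {f g} s t hst => by
    have h₁ : ((restrictFull F P Q h).map₂ s).hom = ((restrictFull F P Q h).map₂ t).hom :=
      congrArg InducedBicategory.Hom₂.hom hst
    exact InducedBicategory.hom₂_ext ((F.mapFunctor a.1 b.1).map_injective h₁)⟩
  full := ⟨fun {f g} s => ⟨⟨(F.mapFunctor a.1 b.1).preimage s.hom⟩, InducedBicategory.hom₂_ext
    ((F.mapFunctor a.1 b.1).map_preimage s.hom)⟩⟩
  essSurj := ⟨fun f => ⟨InducedBicategory.mkHom ((F.mapFunctor a.1 b.1).objPreimage f.hom),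
    ⟨InducedBicategory.isoMk ((F.mapFunctor a.1 b.1).objObjPreimageIso f.hom)⟩⟩⟩

end Whitehead

/-! ### Morphisms between butterflies of morphisms, and split butterflies -/

namespace Butterfly

variable {K : Type v} [CommRing K] {W V : TwoTermLInf.{v, u} K}

section OfMor

variable {g f : TwoTermLInf.Mor W V} (s : Mor (ofMor g) (ofMor f))

/-- The linear map `θ` read off from a morphism `(k, x) ↦ (k - θ x, x)` between butterflies of
morphisms. -/
def theta : W.V₀ →ₗ[K] V.V₁ :=
  -(LinearMap.fst K V.V₁ W.V₀ ∘ₗ s.φ ∘ₗ LinearMap.inr K V.V₁ W.V₀)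

theorem φ_eq_theta (k : V.V₁) (x : W.V₀) : s.φ ((k, x) : V.V₁ × W.V₀) = (k - theta s x, x) := by
  have h₁ : s.φ ((k, 0) : V.V₁ × W.V₀) = ((k, 0) : V.V₁ × W.V₀) := s.φ_ι k
  have h₂ : ((k, x) : V.V₁ × W.V₀) = (k, 0) + (0, x) := by simp
  have h₃ : s.φ ((0, x) : V.V₁ × W.V₀) = ((-theta s x, x) : V.V₁ × W.V₀) :=
    Prod.ext (neg_neg _).symm (s.σ_φ ((0, x) : V.V₁ × W.V₀))
  rw [h₂]
  refine (map_add s.φ _ _).trans ?_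
  rw [h₁, h₃]
  refine Prod.ext ?_ ?_
  · exact (sub_eq_add_neg _ _).symm
  · exact zero_add _

theorem f₀_eq (x : W.V₀) : f.f₀ x = g.f₀ x + V.d (theta s x) := by
  have h := s.ρ_φ ((0, x) : V.V₁ × W.V₀)
  rw [φ_eq_theta] at h
  have h' : V.d (0 - theta s x) + f.f₀ x = V.d 0 + g.f₀ x := h
  rw [zero_sub, map_neg, map_zero, zero_add] at h'
  rw [← h']
  abel

/-- The transformation underlying a morphism between butterflies of morphisms: the compatibility
of the latter with `ρ`, `κ` and the brackets gives the three axioms. -/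
def toTrans : TwoTermLInf.Trans g f where
  θ := theta s
  f₀_sub x := by
    rw [f₀_eq s, add_sub_cancel_left]
  f₁_sub l := by
    have h := s.φ_κ l
    have h' : s.φ ((-g.f₁ l, W.d l) : V.V₁ × W.V₀) = ((-f.f₁ l, W.d l) : V.V₁ × W.V₀) := h
    rw [φ_eq_theta] at h'
    have h'' : -g.f₁ l - theta s (W.d l) = -f.f₁ l := congrArg Prod.fst h'
    rw [← neg_neg (f.f₁ l), ← h'']
    abel
  br_θ x y := by
    have h : s.φ (ofMorBr g (0, x) (0, y)) =
        ofMorBr f (s.φ ((0, x) : V.V₁ × W.V₀)) (s.φ ((0, y) : V.V₁ × W.V₀)) :=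
      s.φ_br ((0, x) : V.V₁ × W.V₀) ((0, y) : V.V₁ × W.V₀)
    rw [φ_eq_theta s 0 x, φ_eq_theta s 0 y, ofMorBr_apply, ofMorBr_apply, φ_eq_theta] at h
    have h' := congrArg Prod.fst h
    simp only [f₀_eq s, map_zero, neg_zero, zero_sub, zero_add, map_add, LinearMap.add_apply, map_neg,
      LinearMap.neg_apply, neg_neg] at h'
    rw [V.act_d (theta s y) (theta s x)] at h'
    rw [← sub_eq_zero] at h' ⊢
    rw [← h']
    abel

end OfMor

section Section

/-- A linear section of `σ` determines a linear retraction of `ι`. -/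
theorem exists_retraction (B : Butterfly W V) {s : W.V₀ →ₗ[K] B.E}
    (hs : B.σ ∘ₗ s = LinearMap.id) :
    ∃ r : B.E →ₗ[K] V.V₁, ∀ a, B.ι (r a) = a - s (B.σ a) := by
  have h : ∀ a, ∃ k, B.ι k = a - s (B.σ a) := fun a =>
    (B.exact _).1 (by
      rw [map_sub, ← LinearMap.comp_apply B.σ s, hs, LinearMap.id_apply, sub_self])
  choose r hr using h
  refine ⟨{ toFun := r, map_add' := fun a b => ?_, map_smul' := fun c a => ?_ }, hr⟩
  · apply B.ι_injective
    simp only [map_add, hr]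
    abel
  · apply B.ι_injective
    simp only [map_smul, hr, smul_sub, RingHom.id_apply]

variable {B : Butterfly W V} {s : W.V₀ →ₗ[K] B.E} (hs : B.σ ∘ₗ s = LinearMap.id)
  {r : B.E →ₗ[K] V.V₁} (hr : ∀ a, B.ι (r a) = a - s (B.σ a))

/-- The morphism of Lie 2-algebras obtained from a butterfly, a linear section `s` of `σ` and the
corresponding retraction `r` of `ι`. Its bilinear part measures the failure of `s` to preserve
brackets: `ι ε(x, y) = [s x, s y] - s [x, y]`. -/
def morOfSection : TwoTermLInf.Mor W V :=
  have hσ : ∀ x, B.σ (s x) = x := fun x => LinearMap.congr_fun hs x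
  have hε : ∀ x y, B.ι (r (B.br (s x) (s y))) = B.br (s x) (s y) - s (W.br x y) := by
    intro x y
    rw [hr, B.σ_br, hσ, hσ]
  have h₁ : ∀ l, B.ι (-r (B.κ l)) = s (W.d l) - B.κ l := by
    intro l
    rw [map_neg, hr, B.σ_κ, neg_sub]
  { f₀ := B.ρ ∘ₗ s
    f₁ := -(r ∘ₗ B.κ)
    eps := (B.br.compl₁₂ s s).compr₂ r
    comm := fun l => by
      change V.d (-r (B.κ l)) = B.ρ (s (W.d l))
      rw [← B.ρ_ι, h₁, map_sub, B.ρ_κ, sub_zero]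
    eps_antisymm := fun x y => by
      change r (B.br (s x) (s y)) = -r (B.br (s y) (s x))
      rw [B.br_antisymm, map_neg]
    br_f₀ := fun x y => by
      change V.br (B.ρ (s x)) (B.ρ (s y)) - B.ρ (s (W.br x y)) = V.d (r (B.br (s x) (s y)))
      rw [← B.ρ_ι, hε, map_sub, B.ρ_br]
    act_f₁ := fun x k => by
      change V.act (B.ρ (s x)) (-r (B.κ k)) - -r (B.κ (W.act x k)) =
        r (B.br (s x) (s (W.d k)))
      apply B.ι_injective
      rw [map_sub, ← B.br_ι, h₁, h₁, hε, map_sub, B.br_κ, hσ, W.d_act]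
      abel
    jac_f := fun x y z => by
      change V.jac (B.ρ (s x)) (B.ρ (s y)) (B.ρ (s z)) - -r (B.κ (W.jac x y z)) =
        r (B.br (s x) (s (W.br y z))) + r (B.br (s y) (s (W.br z x))) +
          r (B.br (s z) (s (W.br x y))) + V.act (B.ρ (s x)) (r (B.br (s y) (s z))) +
          V.act (B.ρ (s y)) (r (B.br (s z) (s x))) + V.act (B.ρ (s z)) (r (B.br (s x) (s y)))
      apply B.ι_injective
      have h := B.jacobi (s x) (s y) (s z)
      rw [hσ, hσ, hσ] at h
      rw [map_sub, h₁, eq_sub_of_add_eq h, W.d_jac]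
      simp only [map_add, ← B.br_ι, hε, map_sub]
      abel }

/-- A linear section of `σ` splits the butterfly as `V₁ ⊕ W₀`. -/
def ofMorOfSection : Mor (ofMor (morOfSection hs hr)) B where
  φ := B.ι ∘ₗ LinearMap.fst K V.V₁ W.V₀ + s ∘ₗ LinearMap.snd K V.V₁ W.V₀
  φ_κ l := by
    change B.ι (- -r (B.κ l)) + s (W.d l) = B.κ l
    rw [neg_neg, hr, B.σ_κ, sub_add_cancel]
  φ_ι k := by
    change B.ι k + s 0 = B.ι k
    rw [map_zero, add_zero]
  σ_φ a := by
    change B.σ (B.ι a.1 + s a.2) = a.2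
    rw [map_add, B.exact.apply_apply_eq_zero, zero_add]
    exact LinearMap.congr_fun hs a.2
  ρ_φ a := by
    change B.ρ (B.ι a.1 + s a.2) = V.d a.1 + B.ρ (s a.2)
    rw [map_add, B.ρ_ι]
  φ_br a b := by
    obtain ⟨k, x⟩ := a
    obtain ⟨l, y⟩ := b
    have hσ : ∀ x, B.σ (s x) = x := fun x => LinearMap.congr_fun hs x
    change B.ι (V.act (V.d k) l + V.act (B.ρ (s x)) l + -V.act (B.ρ (s y)) k
        + r (B.br (s x) (s y))) + s (W.br x y) = B.br (B.ι k + s x) (B.ι l + s y)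
    have e₁ : B.br (B.ι k) (s y) = -B.ι (V.act (B.ρ (s y)) k) := by
      rw [B.br_antisymm, B.br_ι]
    simp only [map_add, LinearMap.add_apply, B.br_ι, B.ρ_ι, map_neg, hr, e₁, B.σ_br, hσ]
    abel

end Section

end Butterfly

/-! ### The butterfly construction on hom-categories -/

section Hom

variable (K : Type v) [CommRing K]

theorem butterflyFunctor_full (W V : TwoTermLInf.{v, u} K) :
    ((butterflyFunctor K).mapFunctor W V).Full where
  map_surjective s := ⟨Butterfly.toTrans s, Butterfly.hom_ext fun x =>
    (Butterfly.φ_eq_theta s x.1 x.2).symm⟩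

theorem butterflyFunctor_faithful (W V : TwoTermLInf.{v, u} K) :
    ((butterflyFunctor K).mapFunctor W V).Faithful where
  map_injective {g f} s t h := TwoTermLInf.hom₂_ext fun x => by
    have h₁ : Butterfly.ofTrans s = Butterfly.ofTrans t := h
    have h₂ : ((0 - TwoTermLInf.Trans.θ s x, x) : V.V₁ × W.V₀) =
        (0 - TwoTermLInf.Trans.θ t x, x) :=
      congrArg (fun m => Butterfly.Mor.φ m ((0, x) : V.V₁ × W.V₀)) h₁
    exact sub_right_injective (congrArg Prod.fst h₂)

theorem butterflyFunctor_essImage_iff (W V : TwoTermLInf.{v, u} K) (B : Butterfly W V) :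
    ((butterflyFunctor K).mapFunctor W V).essImage B ↔
      ∃ s : W.V₀ →ₗ[K] B.E, B.σ ∘ₗ s = LinearMap.id := by
  constructor
  · rintro ⟨f, ⟨i⟩⟩
    let t : Butterfly.Mor (Butterfly.ofMor f) B := i.hom
    exact ⟨t.φ ∘ₗ LinearMap.inr K V.V₁ W.V₀, LinearMap.ext fun x =>
      t.σ_φ ((0, x) : V.V₁ × W.V₀)⟩
  · rintro ⟨s, hs⟩
    obtain ⟨r, hr⟩ := B.exists_retraction hs
    exact ⟨Butterfly.morOfSection hs hr, ⟨Butterfly.isoOfMor (Butterfly.ofMorOfSection hs hr)⟩⟩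

theorem butterflyFunctor_isEquivalence (W V : TwoTermLInf.{v, u} K) [Module.Projective K W.V₀] :
    ((butterflyFunctor K).mapFunctor W V).IsEquivalence where
  full := butterflyFunctor_full K W V
  faithful := butterflyFunctor_faithful K W V
  essSurj := ⟨fun (B : Butterfly W V) => (butterflyFunctor_essImage_iff K W V B).2
    (Module.projective_lifting_property (Butterfly.σ B) LinearMap.id (Butterfly.σ_surjective B))⟩

end Hom

theorem propositionP (K : Type v) [CommRing K] :
    -- over every `K`, the butterfly construction is fully faithful on hom-groupoids
    (∀ W V : TwoTermLInf.{v, u} K,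
      ((butterflyFunctor K).mapFunctor W V).Full ∧
      ((butterflyFunctor K).mapFunctor W V).Faithful) ∧
    -- and it reaches exactly the butterflies that admit a linear section of `σ`
    (∀ (W V : TwoTermLInf.{v, u} K) (B : Butterfly W V),
      ((butterflyFunctor K).mapFunctor W V).essImage B ↔
        ∃ s : W.V₀ →ₗ[K] B.E, B.σ ∘ₗ s = LinearMap.id) ∧
    -- it is a biequivalence on every class of objects with projective degree-zero modules
    (∀ P : Set (TwoTermLInf.{v, u} K), (∀ V ∈ P, Module.Projective K V.V₀) →
      IsBiequivalence (restrictFull (butterflyFunctor K) P {V | V.as ∈ P} fun _ h => h)) ∧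
    -- and on all objects if all modules are projective, e.g. if `K` is a field
    ((∀ V : TwoTermLInf.{v, u} K, Module.Projective K V.V₀) →
      IsBiequivalence (butterflyFunctor.{v, u} K)) := by
  refine ⟨fun W V => ⟨butterflyFunctor_full K W V, butterflyFunctor_faithful K W V⟩,
    butterflyFunctor_essImage_iff K, fun P hP => ?_, fun h => ?_⟩
  · refine isBiequivalence_of_isEquivalence_mapFunctor _ (fun a b => ?_) fun c => ?_
    · have := hP a.1 a.2
      exact isEquivalence_restrictFull _ _ _ _ a b (butterflyFunctor_isEquivalence K a.1 b.1)
    · exact ⟨(⟨c.1.as, c.2⟩ : {V // V ∈ P}), ⟨Bicategory.Equivalence.id c⟩⟩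
  · refine isBiequivalence_of_isEquivalence_mapFunctor _ (fun a b => ?_) fun c => ?_
    · have := h a
      exact butterflyFunctor_isEquivalence K a b
    · exact ⟨c.as, ⟨Bicategory.Equivalence.id c⟩⟩
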